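/- \textbf{Setting.} Let $\Lambda\subset\mathbb{R}^k$ be compact, let $\mu$ be a Borel probability measure on $\Lambda$, and let $\mathcal N\in\mathbb N$. For every $\lambda\in\Lambda$ let $\mathbb I_\lambda=\{f_\lambda^1,\dots,f_\lambda^{\mathcal N(\lambda)}\}$, with $0\le\mathcal N(\lambda)\le\mathcal N$, be a finite family of similarities $f_\lambda^i:\mathbb{R}^d\to\mathbb{R}^d$, $\|f_\lambda^i(x)-f_\lambda^i(y)\|=c_\lambda^i\|x-y\|$, where $\mathcal N(\lambda)$ and $c_\lambda^i$ depend measurably on $\lambda$. Assume that $\mathbb I_\lambda=\varnothing$ if and only if $\lambda=0$, and that $0$, if it lies in $\Lambda$, is an isolated point of $\Lambda$. The pair $(\mathbb L,\mu)$ with $\mathbb L=\{\mathbb I_\lambda\}_{\lambda\in\Lambda}$ is called a random iterated function system (RIFS). It - is \emph{non-extinguishing} if $\int_\Lambda\mathcal N(\lambda)\,d\mu(\lambda)>1$; - satisfies the \emph{contraction condition} if there are $0<c_{\min}\le c_{\max}<1$ with $c_{\min}\le c_\lambda^i\le c_{\max}$ for all $\lambda\in\Lambda\setminus\{0\}$ and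 $1\le i\le\mathcal N(\lambda)$; - satisfies the \emph{uniform open set condition (UOSC)} if there is a non-empty open set $\mathcal O\subseteq\mathbb{R}^d$ such that, for every $\lambda\in\Lambda\setminus\{0\}$, the sets $f_\lambda^i(\mathcal O)$, $1\le i\le\mathcal N(\lambda)$, are contained in $\mathcal O$ and pairwise disjoint. Let $\mathfrak T=\bigcup_{n\ge0}\{1,\dots,\mathcal N\}^n$ be the rooted $\mathcal N$-ary tree, with root $()$, and let $\mathcal T=\Lambda^{\mathfrak T}$ be the set of its labellings. Let $\Delta\subset\mathbb{R}^d$ be a non-empty compact set with $f_\lambda^i(\Delta)\subseteq\Delta$ for all $\lambda\in\Lambda$ and $1\le i\le\mathcal N(\lambda)$. For $\tau\in\mathcal T$ put \[ F_\tau=\bigcap_{n\ge1}\ \bigcup_{(v_1,\dots,v_n)} f^{v_1}_{\tau(())}\circ f^{v_2}_{\tau((v_1))}\circ\cdots\circ f^{v_n}_{\tau((v_1,\dots,v_{n-1}))}(\Delta), \] where the union is over all $(v_1,\dots,v_n)\in\{1,\dots,\mathcal N\}^n$ with $v_j\le\mathcal N(\tau((v_1,\dots,v_{j-1})))$ for $1\le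 j\le n$. The random homogeneous ($1$-variable) measure $\mathbb P_1$ on $\mathcal T$ is the law of the labelling $v\mapsto\lambda_{|v|}$, where $|v|$ is the level of the node $v$ and $\lambda_0,\lambda_1,\dots$ are independent with distribution $\mu$. For a bounded set $F\subset\mathbb{R}^d$ of diameter $|F|$ let $N_r(X)$ be the minimal number of sets of diameter at most $r$ that cover $X$, let $N_{r,R}(F)=\sup_{x\in F}N_r(B(x,R)\cap F)$ with open balls $B(x,R)$, and for $\delta>0$ let \[ h(\delta,F)=\inf\{\alpha\ge0 \mid \exists C>0\ \forall r,R>0:\ r\le R^{1+\delta}\le|F|\Rightarrow N_{r,R}(F)\le C(R/r)^\alpha\}. \] The quasi-Assouad dimension of $F$ is $\dim_{qA}F=\lim_{\delta\to0^+}h(\delta,F)$, and $\dim_H$ denotes the Hausdorff dimension. \textbf{Theorem.} Let $(\mathbb L,\mu)$ be a non-extinguishing RIFS that satisfies the UOSC and the contraction condition, and assume $\mu(\{0\})=0$. Then, for $\mathbb P_1$-almost every $\tau\in\mathcal T$, the limit defining $\dim_{qA}F_\tau$ exists and \[ \dim_{qA}F_\tau=\dim_HF_\tau . \] -/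

import Mathlib

open Set Filter Topology MeasureTheory
open scoped NNReal ENNReal

/-! ### Covering numbers and the quasi-Assouad dimension -/

/-- `N_r(X)`: the minimal number of sets of diameter at most `r` needed to cover `X`
(`⊤` if there is no finite cover). -/
noncomputable def coverNum {M : Type*} [MetricSpace M] (r : ℝ) (X : Set M) : ℕ∞ :=
  ⨅ (𝒰 : Set (Set M)) (_ : X ⊆ ⋃₀ 𝒰) (_ : ∀ U ∈ 𝒰, Metric.ediam U ≤ ENNReal.ofReal r), 𝒰.encard

/-- `N_{r,R}(F) = max_{x ∈ F} N_r(B(x,R) ∩ F)`. -/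
noncomputable def localCoverNum {M : Type*} [MetricSpace M] (r R : ℝ) (F : Set M) : ℕ∞ :=
  ⨆ x ∈ F, coverNum r (Metric.ball x R ∩ F)

/-- `h(δ,F)`: the infimum of all exponents `α ≥ 0` for which there is `C > 0` such that
`N_{r,R}(F) ≤ C (R/r)^α` whenever `0 < r ≤ R^(1+δ) ≤ |F|`. -/
noncomputable def assouadExponent {M : Type*} [MetricSpace M] (δ : ℝ) (F : Set M) : ℝ≥0∞ :=
  ⨅ (α : ℝ≥0) (_ : ∃ C : ℝ, 0 < C ∧ ∀ r R : ℝ, 0 < r → 0 < R → r ≤ R ^ (1 + δ) →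
      R ^ (1 + δ) ≤ Metric.diam F →
      (localCoverNum r R F : ℝ≥0∞) ≤ ENNReal.ofReal (C * (R / r) ^ (α : ℝ))), (α : ℝ≥0∞)

/-- The quasi-Assouad dimension `lim_{δ → 0+} h(δ,F)` of `F` exists and is equal to `s`. -/
def IsQuasiAssouadDim {M : Type*} [MetricSpace M] (F : Set M) (s : ℝ≥0∞) : Prop :=
  Tendsto (fun δ : ℝ => assouadExponent δ F) (𝓝[>] 0) (𝓝 s)

/-! ### Random iterated function systems -/

/-- A random iterated function system of similarities of `ℝ^d`, indexed by a compact set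
`Λ ⊆ ℝ^k` that carries a Borel probability measure `μ`. The iterated function system with
index `l` consists of the maps `map l i` with `i < numMaps l`; the other values of `map l` and
`ratio l` are never used. -/
structure RIFS (k d : ℕ) where
  /-- the index set -/
  Λ : Set (EuclideanSpace ℝ (Fin k))
  isCompact_Λ : IsCompact Λ
  /-- the distribution of the index -/
  μ : Measure Λ
  isProbabilityMeasure_μ : IsProbabilityMeasure μ
  /-- a common upper bound for the number of maps -/
  maxMaps : ℕ
  /-- the number of maps of each iterated function system -/
  numMaps : Λ → ℕ
  numMaps_le : ∀ l, numMaps l ≤ maxMaps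
  /-- `0`, if it belongs to `Λ`, is an isolated point of `Λ` -/
  isolated_zero : ¬ AccPt (0 : EuclideanSpace ℝ (Fin k)) (𝓟 Λ)
  /-- `0` is the only index of an empty iterated function system -/
  numMaps_eq_zero_iff : ∀ l : Λ, numMaps l = 0 ↔ (l : EuclideanSpace ℝ (Fin k)) = 0
  map : Λ → Fin maxMaps → EuclideanSpace ℝ (Fin d) → EuclideanSpace ℝ (Fin d)
  /-- the contraction rates -/
  ratio : Λ → Fin maxMaps → ℝ
  dist_map : ∀ (l : Λ) (i : Fin maxMaps), (i : ℕ) < numMaps l →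
    ∀ x y, dist (map l i x) (map l i y) = ratio l i * dist x y
  /-- the number of maps is a random variable -/
  measurable_numMaps : Measurable numMaps
  /-- the contraction rates are random variables -/
  measurable_ratio : ∀ i : Fin maxMaps,
    Measurable fun l => if (i : ℕ) < numMaps l then ratio l i else 0

namespace RIFS

variable {k d : ℕ} (L : RIFS k d)

/-- All contraction rates lie in some `[c_min, c_max]` with `0 < c_min ≤ c_max < 1`. -/
def ContractionCondition : Prop :=
  ∃ cmin cmax : ℝ, 0 < cmin ∧ cmin ≤ cmax ∧ cmax < 1 ∧
    ∀ (l : L.Λ) (i : Fin L.maxMaps), (i : ℕ) < L.numMaps l →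
      cmin ≤ L.ratio l i ∧ L.ratio l i ≤ cmax

/-- The expected number of maps exceeds `1`. -/
def NonExtinguishing : Prop :=
  1 < ∫ l, (L.numMaps l : ℝ) ∂L.μ

/-- The uniform open set condition. -/
def UOSC : Prop :=
  ∃ O : Set (EuclideanSpace ℝ (Fin d)), IsOpen O ∧ O.Nonempty ∧
    (∀ (l : L.Λ) (i : Fin L.maxMaps), (i : ℕ) < L.numMaps l → L.map l i '' O ⊆ O) ∧
    (∀ (l : L.Λ) (i j : Fin L.maxMaps), (i : ℕ) < L.numMaps l → (j : ℕ) < L.numMaps l →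
      (L.map l i '' O ∩ L.map l j '' O).Nonempty → i = j)

/-- Nodes of the rooted tree in which every node has `maxMaps` children. The root is `[]`, the
first entry of a node is the branch taken at the root. -/
abbrev Node : Type := List (Fin L.maxMaps)

/-- Labellings of the tree by elements of `Λ`. -/
abbrev Labelling : Type := L.Node → L.Λ

/-- The letter `e_l^j` that represents the map `map l j`. -/
abbrev Letter : Type := L.Λ × Fin L.maxMaps

variable {L}

/-- The letter `e_l^j`, or `none` (extinction) if the system `l` has no `j`-th map. -/
def letter (l : L.Λ) (j : Fin L.maxMaps) : Option L.Letter :=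
  if (j : ℕ) < L.numMaps l then some (l, j) else none

/-- The label of a node in the coding tree of `τ`: the concatenation of the letters along the
path from the root to the node, where `none` annihilates. The tree `fun w => τ (j :: w)` is the
full subtree of `τ` at the child `j` of the root. -/
def coding (τ : L.Labelling) : L.Node → Option (List L.Letter)
  | [] => some []
  | j :: v => Option.map₂ List.cons (letter (τ []) j) (coding (fun w => τ (j :: w)) v)

/-- The (non-extinct) codings at level `n` of the coding tree of `τ`. -/
def codingsAt (τ : L.Labelling) (n : ℕ) : Set (List L.Letter) :=
  {e | ∃ v : L.Node, v.length = n ∧ coding τ v = some e}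

/-- The composition `f_{e_1} ∘ f_{e_2} ∘ ⋯ ∘ f_{e_n}` that belongs to a coding. -/
def codingMap : List L.Letter → EuclideanSpace ℝ (Fin d) → EuclideanSpace ℝ (Fin d)
  | [] => id
  | a :: e => L.map a.1 a.2 ∘ codingMap e

/-- The attractor `F_τ`, built from the compact set `Δ`. -/
def attractor (Δ : Set (EuclideanSpace ℝ (Fin d))) (τ : L.Labelling) :
    Set (EuclideanSpace ℝ (Fin d)) :=
  ⋂ (n : ℕ) (_ : 1 ≤ n), ⋃ e ∈ codingsAt τ n, codingMap e '' Δ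

variable (L)

/-- `Δ` is a non-empty compact set that every map of every system maps into itself. -/
def IsAdmissible (Δ : Set (EuclideanSpace ℝ (Fin d))) : Prop :=
  IsCompact Δ ∧ Δ.Nonempty ∧
    ∀ (l : L.Λ) (i : Fin L.maxMaps), (i : ℕ) < L.numMaps l → L.map l i '' Δ ⊆ Δ

/-- The random homogeneous measure `P₁` on labellings: independent `μ`-distributed labels are
chosen for the levels of the tree, and each node receives the label of its level. -/
noncomputable def homogeneousMeasure : Measure L.Labelling :=
  haveI := L.isProbabilityMeasure_μ
  (Measure.infinitePi fun _ : ℕ => L.μ).map fun ω v => ω v.length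

end RIFS

/-!
By non-extinction, contraction and the intermediate value theorem there is an exponent `s > 0` with
`∫ log (∑ i, ratio l i ^ s) dμ(l) = 0`. For almost every sequence `ω` of labels, the strong law of
large numbers then makes the products of the sums `∑ i, ratio (ω j) i ^ s` over the first `n` levels
subexponential in `n`. Choose a branch at random, independently at each level, with weights
proportional to `ratio (ω j) i ^ s`: a cylinder of contraction rate `r` has probability `r ^ s`, up
to a factor `r ^ (± ε)`. By the open set condition, boundedly many cylinders of rate about `r` meet
a given set of diameter `r`, so the law of the limit point has the same uniform bounds on balls.

The mass distribution principle gives `s ≤ dimH F`. Packing balls with this measure gives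
`assouadExponent δ F ≤ s` for every `δ > 0`: the errors `r ^ (± ε)` are powers of `R / r`, because
`r ≤ R ^ (1 + δ)` makes `R / r` at least a fixed power of `1 / r`, and `ε` is arbitrary. Since
`dimH F ≤ assouadExponent δ F` always holds, all three numbers agree.
-/

lemma encard_mul_le_measure {α M : Type*} [MeasurableSpace M] (ν : Measure M) {C : Set α}
    {s : α → Set M} {V : Set M} {m : ℝ≥0∞} (hs : ∀ y ∈ C, MeasurableSet (s y))
    (hdisj : C.PairwiseDisjoint s) (hm : ∀ y ∈ C, m ≤ ν (s y)) (hV : ∀ y ∈ C, s y ⊆ V) :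
    (C.encard : ℝ≥0∞) * m ≤ ν V :=
  calc (C.encard : ℝ≥0∞) * m = ∑' _ : C, m := by rw [ENNReal.tsum_set_const]
    _ ≤ ∑' y : C, ν (s y) := ENNReal.tsum_le_tsum fun y => hm y y.2
    _ ≤ ν (⋃ y : C, s y) :=
        tsum_meas_le_meas_iUnion_of_disjoint ν (fun y => hs y y.2)
          fun y z hyz => hdisj y.2 z.2 (Subtype.coe_ne_coe.2 hyz)
    _ ≤ ν V := measure_mono (iUnion_subset fun y => hV y y.2)

section CoveringNumbers

variable {M : Type*} [MetricSpace M] {X F : Set M}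

lemma coverNum_le_coveringNumber (r : ℝ≥0) (X : Set M) :
    coverNum (2 * r) X ≤ Metric.coveringNumber r X := by
  refine le_iInf₂ fun C _ => le_iInf fun hC => ?_
  refine (iInf₂_le ((fun y => Metric.closedBall y r) '' C) ?_).trans
    ((iInf_le _ ?_).trans (encard_image_le _ _))
  · rw [sUnion_image]
    exact hC.subset_iUnion_closedBall
  · rintro _ ⟨y, -, rfl⟩
    beta_reduce
    rw [ENNReal.ofReal_mul zero_le_two, ENNReal.ofReal_ofNat, ENNReal.ofReal_coe_nnreal,
      ← Metric.closedEBall_coe]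
    exact Metric.ediam_closedEBall_le

lemma exists_cover_encard_le_coverNum {r : ℝ} (h : coverNum r X ≠ ⊤) :
    ∃ 𝒰 : Set (Set M), X ⊆ ⋃₀ 𝒰 ∧ (∀ U ∈ 𝒰, Metric.ediam U ≤ ENNReal.ofReal r) ∧
      𝒰.encard ≤ coverNum r X := by
  have hlt : coverNum r X < coverNum r X + 1 := (ENat.lt_add_one_iff h).2 le_rfl
  conv_lhs at hlt => rw [coverNum]
  simp only [iInf_lt_iff, exists_prop] at hlt
  simpa only [ENat.lt_add_one_iff h] using hlt

lemma exists_cover_tsum_ediam_rpow_le {r C : ℝ} {α : ℝ≥0} (hr : 0 < r)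
    (h : (coverNum r X : ℝ≥0∞) ≤ ENNReal.ofReal (C * r ^ (-(α : ℝ)))) :
    ∃ 𝒰 : Set (Set M), 𝒰.Countable ∧ X ⊆ ⋃₀ 𝒰 ∧
      (∀ U ∈ 𝒰, Metric.ediam U ≤ ENNReal.ofReal r) ∧
      ∑' U : 𝒰, Metric.ediam (U : Set M) ^ (α : ℝ) ≤ ENNReal.ofReal C := by
  have htop : coverNum r X ≠ ⊤ := by
    rintro htop
    simp [htop] at h
  obtain ⟨𝒰, hcov, hdiam, hcard⟩ := exists_cover_encard_le_coverNum htop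
  refine ⟨𝒰, (encard_ne_top_iff.1 (ne_top_of_le_ne_top htop hcard)).countable, hcov, hdiam, ?_⟩
  calc ∑' U : 𝒰, Metric.ediam (U : Set M) ^ (α : ℝ)
      ≤ ∑' _ : 𝒰, ENNReal.ofReal (r ^ (α : ℝ)) := by
        refine ENNReal.tsum_le_tsum fun U => ?_
        rw [← ENNReal.ofReal_rpow_of_pos hr]
        exact ENNReal.rpow_le_rpow (hdiam U U.2) α.2
    _ = 𝒰.encard * ENNReal.ofReal (r ^ (α : ℝ)) := by rw [ENNReal.tsum_set_const]
    _ ≤ ENNReal.ofReal (C * r ^ (-(α : ℝ))) * ENNReal.ofReal (r ^ (α : ℝ)) := by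
        gcongr
        exact (ENat.toENNReal_le.2 hcard).trans h
    _ = ENNReal.ofReal C := by
        rw [← ENNReal.ofReal_mul' (by positivity), mul_assoc, ← Real.rpow_add hr,
          neg_add_cancel, Real.rpow_zero, mul_one]

lemma hausdorffMeasure_le_of_coverNum_le [MeasurableSpace M] [BorelSpace M] {α : ℝ≥0} {C ρ : ℝ}
    (hρ : 0 < ρ)
    (h : ∀ r : ℝ, 0 < r → r ≤ ρ → (coverNum r X : ℝ≥0∞) ≤ ENNReal.ofReal (C * r ^ (-(α : ℝ)))) :
    μH[(α : ℝ)] X ≤ ENNReal.ofReal C := by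
  have hcover (n : ℕ) := exists_cover_tsum_ediam_rpow_le (X := X) (r := ρ / (n + 1 : ℕ)) (C := C)
    (α := α) (by positivity) (h _ (by positivity) (div_le_self hρ.le (by simp)))
  choose 𝒰 hcount hcov hdiam hsum using hcover
  have : ∀ n, Countable (𝒰 n) := fun n => (hcount n).to_subtype
  have hscale : Tendsto (fun n : ℕ => ENNReal.ofReal (ρ / (n + 1 : ℕ))) atTop (𝓝 0) := by
    rw [← ENNReal.ofReal_zero]
    exact ENNReal.tendsto_ofReal
      ((tendsto_const_div_atTop_nhds_zero_nat ρ).comp (tendsto_add_atTop_nat 1))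
  calc μH[(α : ℝ)] X
      ≤ liminf (fun n => ∑' U : 𝒰 n, Metric.ediam (U : Set M) ^ (α : ℝ)) atTop :=
        Measure.hausdorffMeasure_le_liminf_tsum _ X _ hscale (fun n (U : 𝒰 n) => (U : Set M))
          (.of_forall fun n U => hdiam n U U.2)
          (.of_forall fun n => (hcov n).trans_eq sUnion_eq_iUnion)
    _ ≤ ENNReal.ofReal C := liminf_le_of_frequently_le' (.of_forall hsum)

lemma dimH_ball_inter_le {α : ℝ≥0} {C R ρ : ℝ} (hR : 0 < R) (hρ : 0 < ρ)
    (h : ∀ r : ℝ, 0 < r → r ≤ ρ →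
      (localCoverNum r R F : ℝ≥0∞) ≤ ENNReal.ofReal (C * (R / r) ^ (α : ℝ)))
    {x : M} (hx : x ∈ F) : dimH (Metric.ball x R ∩ F) ≤ α := by
  borelize M
  refine dimH_le_of_hausdorffMeasure_ne_top (ne_top_of_le_ne_top ENNReal.ofReal_ne_top
    (hausdorffMeasure_le_of_coverNum_le (C := C * R ^ (α : ℝ)) hρ fun r hr hrρ => ?_))
  have hlocal : coverNum r (Metric.ball x R ∩ F) ≤ localCoverNum r R F :=
    le_iSup₂ (f := fun x (_ : x ∈ F) => coverNum r (Metric.ball x R ∩ F)) x hx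
  calc (coverNum r (Metric.ball x R ∩ F) : ℝ≥0∞)
      ≤ ENNReal.ofReal (C * (R / r) ^ (α : ℝ)) :=
        (ENat.toENNReal_le.2 hlocal).trans (h r hr hrρ)
    _ = ENNReal.ofReal (C * R ^ (α : ℝ) * r ^ (-(α : ℝ))) := by
        rw [Real.div_rpow hR.le hr.le, Real.rpow_neg hr.le, mul_assoc, div_eq_mul_inv]

lemma dimH_le_of_forall_dimH_ball_inter_le [SecondCountableTopology M] {R : ℝ} (hR : 0 < R)
    {a : ℝ≥0∞} (h : ∀ x ∈ F, dimH (Metric.ball x R ∩ F) ≤ a) : dimH F ≤ a := by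
  by_contra! hlt
  obtain ⟨x, hx, hnhds⟩ := exists_mem_nhdsWithin_lt_dimH_of_lt_dimH hlt
  exact (hnhds _ (inter_mem (mem_nhdsWithin_of_mem_nhds (Metric.ball_mem_nhds x hR))
    self_mem_nhdsWithin)).not_ge (h x hx)

lemma dimH_le_assouadExponent [SecondCountableTopology M] (hF : Bornology.IsBounded F) {δ : ℝ}
    (hδ : 0 < δ) : dimH F ≤ assouadExponent δ F := by
  refine le_iInf₂ fun α ⟨C, _, h⟩ => ?_
  rcases F.subsingleton_or_nontrivial with hsub | hnontriv
  · simp [dimH_subsingleton hsub]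
  have hdiam : 0 < Metric.diam F := Metric.diam_pos hnontriv hF
  -- the largest scale that the definition of `assouadExponent` admits
  set R := Metric.diam F ^ (1 + δ)⁻¹
  have hR : 0 < R := Real.rpow_pos_of_pos hdiam _
  have hRδ : R ^ (1 + δ) = Metric.diam F := Real.rpow_inv_rpow hdiam.le (by positivity)
  exact dimH_le_of_forall_dimH_ball_inter_le hR fun x hx => dimH_ball_inter_le hR hdiam
    (fun r hr hrF => h r R hr hR (hRδ ▸ hrF) hRδ.le) hx

variable [MeasurableSpace M] {ν : Measure M}

lemma coverNum_mul_le_measure [OpensMeasurableSpace M] {V : Set M} {r : ℝ} {m : ℝ≥0∞} (hr : 0 < r)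
    (hm : ∀ y ∈ X, m ≤ ν (Metric.ball y (r / 4))) (hV : ∀ y ∈ X, Metric.ball y (r / 4) ⊆ V) :
    (coverNum r X : ℝ≥0∞) * m ≤ ν V := by
  lift r to ℝ≥0 using hr.le
  have hcover : coverNum r X ≤ Metric.packingNumber (r / 2) X := by
    have h := (coverNum_le_coveringNumber (r / 2) X).trans
      (Metric.coveringNumber_le_packingNumber _ _)
    rwa [NNReal.coe_div, NNReal.coe_ofNat, mul_div_cancel₀ _ two_ne_zero] at h
  refine (mul_le_mul_left (ENat.toENNReal_le.2 hcover) m).trans ?_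
  simp only [Metric.packingNumber, ENat.toENNReal_iSup, ENNReal.iSup_mul, iSup_le_iff]
  intro T hT hsep
  refine encard_mul_le_measure ν (fun y _ => measurableSet_ball) (fun y hy z hz hyz => ?_)
    (fun y hy => hm y (hT hy)) fun y hy => hV y (hT hy)
  have hdist : ((r / 2 : ℝ≥0) : ℝ≥0∞) < edist y z := hsep hy hz hyz
  rw [edist_nndist, ENNReal.coe_lt_coe, ← NNReal.coe_lt_coe, coe_nndist] at hdist
  push_cast at hdist
  exact Metric.ball_disjoint_ball (by linarith)

lemma localCoverNum_mul_le [OpensMeasurableSpace M] {r R : ℝ} {a b : ℝ≥0∞} (hr : 0 < r)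
    (ha : ∀ y ∈ F, a ≤ ν (Metric.ball y (r / 4)))
    (hb : ∀ x ∈ F, ν (Metric.ball x (R + r)) ≤ b) : (localCoverNum r R F : ℝ≥0∞) * a ≤ b := by
  simp only [localCoverNum, ENat.toENNReal_iSup, ENNReal.iSup_mul, iSup_le_iff]
  refine fun x hx => (coverNum_mul_le_measure hr (fun y hy => ha y hy.2) fun y hy => ?_).trans
    (hb x hx)
  have := Metric.mem_ball.1 hy.1
  exact Metric.ball_subset_ball' (by linarith)

lemma measure_le_mul_ediam_rpow {t C : ℝ} (ht : 0 < t) (hC : 0 < C)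
    (hν : ∀ (U : Set M) (ρ : ℝ), 0 < ρ → Metric.ediam U ≤ ENNReal.ofReal ρ →
      ν U ≤ ENNReal.ofReal (C * ρ ^ t)) {U : Set M} (hU : Metric.ediam U ≠ ⊤) :
    ν U ≤ ENNReal.ofReal C * Metric.ediam U ^ t := by
  generalize hD : Metric.ediam U = D at hU ⊢
  lift D to ℝ≥0 using hU
  rw [← ENNReal.ofReal_coe_nnreal, ENNReal.ofReal_rpow_of_nonneg D.coe_nonneg ht.le,
    ← ENNReal.ofReal_mul hC.le]
  have hlim : Tendsto (fun ρ : ℝ => ENNReal.ofReal (C * ρ ^ t)) (𝓝[>] (D : ℝ))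
      (𝓝 (ENNReal.ofReal (C * (D : ℝ) ^ t))) :=
    ENNReal.tendsto_ofReal (((Real.continuousAt_rpow_const _ t (.inr ht.le)).tendsto.mono_left
      nhdsWithin_le_nhds).const_mul C)
  refine ge_of_tendsto hlim ?_
  filter_upwards [self_mem_nhdsWithin] with ρ (hρ : (D : ℝ) < ρ)
  refine hν U ρ (D.coe_nonneg.trans_lt hρ) ?_
  rw [hD, ← ENNReal.ofReal_coe_nnreal]
  exact ENNReal.ofReal_le_ofReal hρ.le

lemma le_dimH_of_measure_le [BorelSpace M] (hF : ν F ≠ 0) {t : ℝ≥0} (ht : 0 < t) {C : ℝ}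
    (hC : 0 < C)
    (hν : ∀ (U : Set M) (ρ : ℝ), 0 < ρ → Metric.ediam U ≤ ENNReal.ofReal ρ →
      ν U ≤ ENNReal.ofReal (C * ρ ^ (t : ℝ))) : (t : ℝ≥0∞) ≤ dimH F := by
  have : ENNReal.ofReal C ≠ 0 := by simpa using hC
  have hle : (ENNReal.ofReal C)⁻¹ • ν ≤ μH[(t : ℝ)] := by
    refine Measure.le_hausdorffMeasure _ _ 1 one_pos fun U hU => ?_
    rw [Measure.smul_apply, smul_eq_mul, mul_comm, ← div_eq_mul_inv]
    exact ENNReal.div_le_of_le_mul' (measure_le_mul_ediam_rpow (NNReal.coe_pos.2 ht) hC hν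
      (ne_top_of_le_ne_top ENNReal.one_ne_top hU))
  refine le_dimH_of_hausdorffMeasure_ne_zero fun hzero => hF ?_
  have hνF := nonpos_iff_eq_zero.1 (hzero ▸ Measure.le_iff'.1 hle F)
  simpa using hνF

end CoveringNumbers

lemma rpow_div_rpow_le {r R t₁ t₂ δ : ℝ} (hr : 0 < r) (hR : 0 < R) (ht : t₁ ≤ t₂) (hδ : 0 < δ)
    (hrR : r ≤ R ^ (1 + δ)) : R ^ t₁ / r ^ t₂ ≤ (R / r) ^ (t₂ + (t₂ - t₁) / δ) := by
  have hscale : R ^ (-δ) ≤ R / r := by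
    rw [le_div_iff₀ hr, ← le_div_iff₀' (by positivity), Real.rpow_neg hR.le, div_inv_eq_mul]
    rwa [Real.rpow_add hR, Real.rpow_one] at hrR
  have : 0 ≤ (t₂ - t₁) / δ := div_nonneg (sub_nonneg.2 ht) hδ.le
  calc R ^ t₁ / r ^ t₂ = (R / r) ^ t₂ * (R ^ (-δ)) ^ ((t₂ - t₁) / δ) := by
        rw [Real.div_rpow hR.le hr.le, ← Real.rpow_mul hR.le, div_mul_eq_mul_div,
          ← Real.rpow_add hR]
        congr 2
        field_simp
        ring
    _ ≤ (R / r) ^ t₂ * (R / r) ^ ((t₂ - t₁) / δ) := by gcongr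
    _ = (R / r) ^ (t₂ + (t₂ - t₁) / δ) := by rw [← Real.rpow_add (by positivity)]

/-- The measure `ν` has uniform local dimension `s` on `F`, up to arbitrarily small errors in the
exponent. The constants may depend on the exponent, but neither on the point nor on the scale. -/
structure IsAlmostRegular {M : Type*} [MetricSpace M] [MeasurableSpace M] (ν : Measure M)
    (F : Set M) (s : ℝ) : Prop where
  le_measure_ball : ∀ t, s < t → ∃ c > 0, ∀ x ∈ F, ∀ r : ℝ, 0 < r → r ≤ 1 →
    ENNReal.ofReal (c * r ^ t) ≤ ν (Metric.ball x r)
  measure_le : ∀ t, 0 < t → t < s → ∃ C > 0, ∀ (U : Set M) (ρ : ℝ), 0 < ρ →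
    Metric.ediam U ≤ ENNReal.ofReal ρ → ν U ≤ ENNReal.ofReal (C * ρ ^ t)

namespace IsAlmostRegular

variable {M : Type*} [MetricSpace M] [MeasurableSpace M] {ν : Measure M} {F : Set M} {s t : ℝ}

lemma exists_le_measure_ball (h : IsAlmostRegular ν F s) (ht : s < t) {B : ℝ} (hB : 1 ≤ B) :
    ∃ c > 0, ∀ x ∈ F, ∀ r : ℝ, 0 < r → r ≤ B →
      ENNReal.ofReal (c * r ^ t) ≤ ν (Metric.ball x r) := by
  obtain ⟨c, hc, hν⟩ := h.le_measure_ball t ht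
  have hB0 : 0 < B := by positivity
  refine ⟨c / B ^ t, by positivity, fun x hx r hr hrB => ?_⟩
  calc ENNReal.ofReal (c / B ^ t * r ^ t) = ENNReal.ofReal (c * (r / B) ^ t) := by
        rw [Real.div_rpow hr.le hB0.le]
        ring_nf
    _ ≤ ν (Metric.ball x (r / B)) := hν x hx _ (by positivity) ((div_le_one hB0).2 hrB)
    _ ≤ ν (Metric.ball x r) := measure_mono (Metric.ball_subset_ball (div_le_self hr.le hB))

lemma exists_measure_ball_le (h : IsAlmostRegular ν F s) (ht₀ : 0 < t) (ht : t < s) {K : ℝ}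
    (hK : 0 < K) : ∃ C > 0, ∀ (x : M) (R R' : ℝ), 0 < R → R' ≤ K * R →
      ν (Metric.ball x R') ≤ ENNReal.ofReal (C * R ^ t) := by
  obtain ⟨C, hC, hν⟩ := h.measure_le t ht₀ ht
  refine ⟨C * (2 * K) ^ t, by positivity, fun x R R' hR hR' => ?_⟩
  have hdiam : Metric.ediam (Metric.ball x R') ≤ ENNReal.ofReal (2 * K * R) := by
    rw [← Metric.eball_ofReal]
    refine Metric.ediam_eball_le.trans ?_
    rw [mul_assoc, ENNReal.ofReal_mul zero_le_two, ENNReal.ofReal_ofNat]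
    gcongr
  refine (hν _ _ (by positivity) hdiam).trans_eq ?_
  rw [Real.mul_rpow (by positivity) hR.le, mul_assoc]

lemma le_dimH [BorelSpace M] (h : IsAlmostRegular ν F s) (hF : ν F ≠ 0) :
    ENNReal.ofReal s ≤ dimH F := by
  refine ENNReal.le_of_forall_nnreal_lt fun t hts => ?_
  rcases eq_zero_or_pos t with rfl | ht
  · simp
  obtain ⟨C, hC, hν⟩ := h.measure_le t (NNReal.coe_pos.2 ht)
    (Real.lt_toNNReal_iff_coe_lt.1 (ENNReal.coe_lt_coe.1 hts))
  exact le_dimH_of_measure_le hF ht hC hν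

lemma assouadExponent_le_add_div [OpensMeasurableSpace M] (h : IsAlmostRegular ν F s)
    {t₁ t₂ δ : ℝ} (ht₁ : 0 < t₁) (ht₁s : t₁ < s) (hst₂ : s < t₂) (hδ : 0 < δ) :
    assouadExponent δ F ≤ ENNReal.ofReal (t₂ + (t₂ - t₁) / δ) := by
  have hα : 0 ≤ t₂ + (t₂ - t₁) / δ := by
    have := div_nonneg (by linarith : 0 ≤ t₂ - t₁) hδ.le
    linarith
  -- `B` bounds all admissible scales
  set B := 1 + Metric.diam F
  have hB1 : 1 ≤ B := le_add_of_nonneg_right Metric.diam_nonneg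
  obtain ⟨c, hc, hlow⟩ := h.exists_le_measure_ball hst₂ hB1
  obtain ⟨C, hC, hup⟩ := h.exists_measure_ball_le ht₁ ht₁s (by positivity : 0 < 1 + B ^ δ)
  refine iInf₂_le_of_le ⟨_, hα⟩ ⟨C / (c * (1 / 4) ^ t₂), by positivity, ?_⟩
    (ENNReal.ofReal_eq_coe_nnreal hα).ge
  intro r R hr hR hrR hRF
  have hRB : R ≤ B := by
    by_contra! hBR
    have := Real.self_le_rpow_of_one_le (hB1.trans hBR.le) (le_add_of_nonneg_right hδ.le)
    linarith
  have hrRB : r ≤ R * B ^ δ := by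
    rw [Real.rpow_add hR, Real.rpow_one] at hrR
    exact hrR.trans (by gcongr)
  have hcount := localCoverNum_mul_le (R := R) hr (fun y hy => hlow y hy (r / 4) (by positivity)
    (by linarith)) fun x _ => hup x R (R + r) hR (by linarith)
  have hpos : 0 < c * (r / 4) ^ t₂ := by positivity
  rw [← ENNReal.le_div_iff_mul_le (.inl (by simpa using hpos)) (.inl ENNReal.ofReal_ne_top),
    ← ENNReal.ofReal_div_of_pos hpos] at hcount
  refine hcount.trans (ENNReal.ofReal_le_ofReal ?_)
  calc C * R ^ t₁ / (c * (r / 4) ^ t₂) = C / (c * (1 / 4) ^ t₂) * (R ^ t₁ / r ^ t₂) := by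
        rw [div_eq_mul_one_div r, Real.mul_rpow hr.le (by norm_num)]
        ring
    _ ≤ C / (c * (1 / 4) ^ t₂) * (R / r) ^ (t₂ + (t₂ - t₁) / δ) := by
        gcongr
        exact rpow_div_rpow_le hr hR (by linarith) hδ hrR

lemma assouadExponent_le [OpensMeasurableSpace M] (h : IsAlmostRegular ν F s) (hs : 0 < s)
    {δ : ℝ} (hδ : 0 < δ) : assouadExponent δ F ≤ ENNReal.ofReal s := by
  have hlim : Tendsto (fun ε : ℝ => ENNReal.ofReal (s + ε + (s + ε - (s - ε)) / δ)) (𝓝[>] 0)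
      (𝓝 (ENNReal.ofReal s)) := by
    have hcont : Continuous fun ε : ℝ => ENNReal.ofReal (s + ε + (s + ε - (s - ε)) / δ) := by
      exact ENNReal.continuous_ofReal.comp (by fun_prop)
    simpa using (hcont.tendsto 0).mono_left nhdsWithin_le_nhds
  refine ge_of_tendsto hlim ?_
  filter_upwards [Ioo_mem_nhdsGT hs] with ε ⟨hε, hεs⟩
  exact h.assouadExponent_le_add_div (by linarith) (by linarith) (by linarith) hδ

theorem isQuasiAssouadDim [BorelSpace M] [SecondCountableTopology M] (h : IsAlmostRegular ν F s)
    (hs : 0 < s) (hF : ν F ≠ 0) (hb : Bornology.IsBounded F) : IsQuasiAssouadDim F (dimH F) := by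
  refine tendsto_const_nhds.congr' ?_
  filter_upwards [self_mem_nhdsWithin] with δ hδ
  exact (dimH_le_assouadExponent hb hδ).antisymm
    ((h.assouadExponent_le hs hδ).trans (h.le_dimH hF))

end IsAlmostRegular

lemma packingNumber_ne_top_of_isCompact {M : Type*} [PseudoEMetricSpace M] {X : Set M}
    (hX : IsCompact X) {r : ℝ≥0} (hr : r ≠ 0) : Metric.packingNumber r X ≠ ⊤ := by
  obtain ⟨N, hNX, hfin, hcover⟩ :=
    Metric.exists_finite_isCover_of_isCompact (div_ne_zero hr two_ne_zero) hX
  have hle := (Metric.packingNumber_two_mul_le_externalCoveringNumber (r / 2) X).trans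
    ((Metric.externalCoveringNumber_le_coveringNumber _ _).trans
      (hcover.coveringNumber_le_encard hNX))
  rw [mul_div_cancel₀ _ two_ne_zero] at hle
  exact ne_top_of_le_ne_top hfin.encard_lt_top.ne hle

section NormedSpace

variable {E : Type*} [NormedAddCommGroup E] [NormedSpace ℝ E]

lemma surjective_of_dist_eq_mul [StrictConvexSpace ℝ E] [FiniteDimensional ℝ E] {f : E → E}
    {c : ℝ} (hc : 0 < c) (hf : ∀ x y, dist (f x) (f y) = c * dist x y) :
    Function.Surjective f := by
  have hiso : Isometry fun x => f (c⁻¹ • x) := Isometry.of_dist_eq fun x y => by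
    rw [hf, dist_smul₀, norm_inv, Real.norm_of_nonneg hc.le, mul_inv_cancel_left₀ hc.ne']
  let : Inhabited E := ⟨0⟩
  intro y
  obtain ⟨x, hx⟩ :=
    (hiso.affineIsometryOfStrictConvexSpace.toAffineIsometryEquiv rfl).surjective y
  exact ⟨c⁻¹ • x, by simpa using hx⟩

lemma image_ball_of_dist_eq_mul [StrictConvexSpace ℝ E] [FiniteDimensional ℝ E] {f : E → E}
    {c : ℝ} (hc : 0 < c) (hf : ∀ x y, dist (f x) (f y) = c * dist x y) (a : E) (η : ℝ) :
    f '' Metric.ball a η = Metric.ball (f a) (c * η) := by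
  have hpre : f ⁻¹' Metric.ball (f a) (c * η) = Metric.ball a η := by
    ext x
    simp only [mem_preimage, Metric.mem_ball, hf, mul_lt_mul_iff_right₀ hc]
  rw [← hpre, image_preimage_eq _ (surjective_of_dist_eq_mul hc hf)]

variable (E) in
lemma exists_encard_le_of_pairwise_le_dist [ProperSpace E] (α : Type*) (K : ℝ) {κ : ℝ}
    (hκ : 0 < κ) : ∃ m : ℕ, ∀ (ρ : ℝ) (x : E) (W : Set α) (f : α → E), 0 < ρ →
      MapsTo f W (Metric.closedBall x (K * ρ)) →
      (W.Pairwise fun y z => κ * ρ ≤ dist (f y) (f z)) → W.encard ≤ m := by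
  lift κ to ℝ≥0 using hκ.le
  rw [NNReal.coe_pos] at hκ
  obtain ⟨m, hm⟩ := ENat.ne_top_iff_exists.1 (packingNumber_ne_top_of_isCompact
    (isCompact_closedBall (0 : E) K) (half_pos hκ).ne')
  refine ⟨m, fun ρ x W f hρ hmaps hsep => ?_⟩
  set g : α → E := fun y => ρ⁻¹ • (f y - x)
  have hdist (y z : α) : ρ * dist (g y) (g z) = dist (f y) (f z) := by
    rw [dist_smul₀, norm_inv, Real.norm_of_nonneg hρ.le, dist_sub_right,
      mul_inv_cancel_left₀ hρ.ne']
  have hκdist {y z : α} (hy : y ∈ W) (hz : z ∈ W) (hyz : y ≠ z) : κ ≤ dist (g y) (g z) := by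
    have h : κ * ρ ≤ dist (f y) (f z) := hsep hy hz hyz
    rwa [← hdist, mul_comm, mul_le_mul_iff_right₀ hρ] at h
  have hinj : InjOn g W := fun y hy z hz hyz => by
    by_contra hne
    have h := hκdist hy hz hne
    rw [hyz, dist_self] at h
    exact hκ.not_ge h
  have hball : g '' W ⊆ Metric.closedBall 0 K := by
    rintro _ ⟨y, hy, rfl⟩
    rw [mem_closedBall_zero_iff, norm_smul, norm_inv, Real.norm_of_nonneg hρ.le,
      inv_mul_le_iff₀' hρ]
    exact mem_closedBall_iff_norm.1 (hmaps hy)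
  have hgsep : Metric.IsSeparated ((κ / 2 : ℝ≥0) : ℝ≥0∞) (g '' W) := by
    rintro _ ⟨y, hy, rfl⟩ _ ⟨z, hz, rfl⟩ hne
    have h := hκdist hy hz (ne_of_apply_ne g hne)
    rw [edist_nndist, ENNReal.coe_lt_coe]
    exact (half_lt_self hκ).trans_le h
  calc W.encard = (g '' W).encard := hinj.encard_image.symm
    _ ≤ m := hm ▸ hgsep.encard_le_packingNumber hball

end NormedSpace

lemma measure_le_encard_mul {α M : Type*} [MeasurableSpace M] (ν : Measure M) {C : Set α}
    (hC : C.Countable) {s : α → Set M} {V : Set M} {m : ℝ≥0∞} (hm : ∀ y ∈ C, ν (s y) ≤ m)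
    (hV : V ⊆ ⋃ y ∈ C, s y) : ν V ≤ C.encard * m :=
  calc ν V ≤ ∑' y : C, ν (s y) := (measure_mono hV).trans (measure_biUnion_le ν hC s)
    _ ≤ ∑' _ : C, m := ENNReal.tsum_le_tsum fun y => hm y y.2
    _ = C.encard * m := by rw [ENNReal.tsum_set_const]

lemma exists_abs_le_mul_add_of_tendsto {u : ℕ → ℝ}
    (hu : Tendsto (fun n : ℕ => u n / n) atTop (𝓝 0)) {ε : ℝ} (hε : 0 < ε) :
    ∃ C : ℝ, ∀ n : ℕ, |u n| ≤ ε * n + C := by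
  have hbdd : IsBoundedUnder (· ≤ ·) atTop fun n : ℕ => |u n| - ε * n := by
    refine isBoundedUnder_of_eventually_le (a := 0) ?_
    filter_upwards [hu.abs.eventually_lt_const (by simpa using hε), eventually_gt_atTop 0]
      with n hn hpos
    rw [abs_div, Nat.abs_cast, div_lt_iff₀ (by positivity)] at hn
    linarith
  obtain ⟨C, hC⟩ := hbdd.bddAbove_range
  exact ⟨C, fun n => by linarith [hC (mem_range_self n)]⟩

/-- A non-autonomous iterated function system: a sequence of families of similarities whose
contraction rates are bounded away from `0` and `1`. The family that acts at level `j` is indexed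
by `ι j`, so that an infinite branch is an element of `∀ j, ι j`. -/
structure SimilaritySystem (E : Type*) [PseudoMetricSpace E] (ι : ℕ → Type*) where
  map : ∀ j, ι j → E → E
  ratio : ∀ j, ι j → ℝ
  cmin : ℝ
  cmax : ℝ
  cmin_pos : 0 < cmin
  cmax_lt_one : cmax < 1
  cmin_le : ∀ j i, cmin ≤ ratio j i
  le_cmax : ∀ j i, ratio j i ≤ cmax
  dist_map : ∀ j i x y, dist (map j i x) (map j i y) = ratio j i * dist x y

namespace SimilaritySystem

section Basic

variable {E : Type*} [PseudoMetricSpace E] {ι : ℕ → Type*} (S : SimilaritySystem E ι)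
  {ξ η : ∀ j, ι j} {m n : ℕ} {ρ : ℝ}

/-- The composition of the first `m` maps along the branch `ξ`. -/
def comp (ξ : ∀ j, ι j) : ℕ → E → E
  | 0 => id
  | m + 1 => comp ξ m ∘ S.map m (ξ m)

/-- The contraction rate of the composition of the first `m` maps along the branch `ξ`. -/
noncomputable def rate (ξ : ∀ j, ι j) (m : ℕ) : ℝ := ∏ j ∈ Finset.range m, S.ratio j (ξ j)

/-- The attractor of the system, built from the forward invariant set `Δ`. -/
def limitSet (Δ : Set E) : Set E := ⋂ (n : ℕ) (_ : 1 ≤ n), ⋃ ξ, S.comp ξ n '' Δ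

/-- The first level at which the contraction rate along `ξ` is at most `ρ`. -/
noncomputable def stoppingTime (ρ : ℝ) (ξ : ∀ j, ι j) : ℕ := sInf {m | S.rate ξ m ≤ ρ}

/-- The branches that agree with `ξ` until it is stopped at scale `ρ`. -/
def stoppedCylinder (ρ : ℝ) (ξ : ∀ j, ι j) : Set (∀ j, ι j) :=
  PiNat.cylinder ξ (S.stoppingTime ρ ξ)

/-- The composition of the maps along `ξ` up to its stopping time: the maps
`S.stoppedComp ρ ξ` are the similarities of the system with contraction rate about `ρ`. -/
noncomputable def stoppedComp (ρ : ℝ) (ξ : ∀ j, ι j) : E → E := S.comp ξ (S.stoppingTime ρ ξ)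

/-- The open set condition, with feasible open set `O`. -/
structure IsFeasible (O : Set E) : Prop where
  isOpen : IsOpen O
  nonempty : O.Nonempty
  mapsTo : ∀ j i, MapsTo (S.map j i) O O
  pairwise_disjoint : ∀ j, Pairwise (Function.onFun Disjoint fun i => S.map j i '' O)

lemma ratio_pos (j : ℕ) (i : ι j) : 0 < S.ratio j i := S.cmin_pos.trans_le (S.cmin_le j i)

lemma rate_pos (ξ : ∀ j, ι j) (m : ℕ) : 0 < S.rate ξ m :=
  Finset.prod_pos fun j _ => S.ratio_pos j _

lemma rate_zero (ξ : ∀ j, ι j) : S.rate ξ 0 = 1 := Finset.prod_range_zero _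

lemma rate_succ (ξ : ∀ j, ι j) (m : ℕ) : S.rate ξ (m + 1) = S.rate ξ m * S.ratio m (ξ m) :=
  Finset.prod_range_succ _ _

lemma rate_le_pow (ξ : ∀ j, ι j) (m : ℕ) : S.rate ξ m ≤ S.cmax ^ m := by
  simpa [rate] using Finset.prod_le_prod (s := Finset.range m)
    (fun j _ => (S.ratio_pos j (ξ j)).le) fun j _ => S.le_cmax j (ξ j)

lemma dist_comp (ξ : ∀ j, ι j) (m : ℕ) (x y : E) :
    dist (S.comp ξ m x) (S.comp ξ m y) = S.rate ξ m * dist x y := by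
  induction m generalizing x y with
  | zero => rw [rate_zero, one_mul, comp, id, id]
  | succ m ih => rw [comp, Function.comp_apply, Function.comp_apply, ih, S.dist_map, rate_succ,
      mul_assoc]

lemma comp_eq_of_mem_cylinder (h : η ∈ PiNat.cylinder ξ m) : S.comp η m = S.comp ξ m := by
  induction m with
  | zero => rfl
  | succ m ih => rw [comp, comp, ih (PiNat.cylinder_anti ξ m.le_succ h), h m m.lt_succ_self]

lemma rate_eq_of_mem_cylinder (h : η ∈ PiNat.cylinder ξ m) : S.rate η m = S.rate ξ m :=
  Finset.prod_congr rfl fun j hj => by rw [h j (Finset.mem_range.1 hj)]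

lemma image_comp_subset_of_le {X : Set E} (hX : ∀ j i, MapsTo (S.map j i) X X)
    (ξ : ∀ j, ι j) (hmn : m ≤ n) : S.comp ξ n '' X ⊆ S.comp ξ m '' X := by
  induction n, hmn using Nat.le_induction with
  | base => rfl
  | succ n _ ih =>
    rw [comp, image_comp]
    exact (image_mono (hX n (ξ n)).image_subset).trans ih

lemma limitSet_subset {Δ : Set E} (hΔ : ∀ j i, MapsTo (S.map j i) Δ Δ) : S.limitSet Δ ⊆ Δ := by
  intro x hx
  obtain ⟨ξ, hξ⟩ := mem_iUnion.1 (mem_iInter₂.1 hx 1 le_rfl)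
  simpa [comp] using S.image_comp_subset_of_le hΔ ξ zero_le_one hξ

lemma stoppingTime_le (h : S.rate ξ m ≤ ρ) : S.stoppingTime ρ ξ ≤ m := Nat.sInf_le h

lemma rate_stoppingTime_le (hρ : 0 < ρ) (ξ : ∀ j, ι j) :
    S.rate ξ (S.stoppingTime ρ ξ) ≤ ρ := by
  obtain ⟨m, hm⟩ := exists_pow_lt_of_lt_one hρ S.cmax_lt_one
  exact Nat.sInf_mem (s := {m | S.rate ξ m ≤ ρ}) ⟨m, (S.rate_le_pow ξ m).trans hm.le⟩

lemma le_rate_stoppingTime (hρ₀ : 0 ≤ ρ) (hρ₁ : ρ ≤ 1) (ξ : ∀ j, ι j) :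
    S.cmin * ρ ≤ S.rate ξ (S.stoppingTime ρ ξ) := by
  have hcmin : S.cmin ≤ 1 := (S.cmin_le 0 (ξ 0)).trans ((S.le_cmax 0 _).trans S.cmax_lt_one.le)
  rcases hm : S.stoppingTime ρ ξ with _ | m
  · rw [rate_zero]
    exact mul_le_one₀ hcmin hρ₀ hρ₁
  · have hlt : ρ < S.rate ξ m := not_le.1 <| Nat.notMem_of_lt_sInf <|
      (Nat.lt_succ_self m).trans_eq hm.symm
    rw [rate_succ, mul_comm]
    exact mul_le_mul hlt.le (S.cmin_le _ _) S.cmin_pos.le (S.rate_pos ξ m).le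

lemma exists_mem_image_stoppedComp {Δ : Set E} (hΔ : ∀ j i, MapsTo (S.map j i) Δ Δ) (hρ : 0 < ρ)
    {x : E} (hx : x ∈ S.limitSet Δ) : ∃ ξ, x ∈ S.stoppedComp ρ ξ '' Δ := by
  obtain ⟨n, hn⟩ := exists_pow_lt_of_lt_one hρ S.cmax_lt_one
  have hstopped : ∀ ξ, S.stoppingTime ρ ξ ≤ n := fun ξ =>
    S.stoppingTime_le ((S.rate_le_pow ξ n).trans hn.le)
  obtain ⟨ξ, hξ⟩ := mem_iUnion.1 (mem_iInter₂.1 hx (n + 1) n.succ_pos)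
  exact ⟨ξ, S.image_comp_subset_of_le hΔ ξ ((hstopped ξ).trans n.le_succ) hξ⟩

lemma stoppingTime_eq_of_mem (hρ : 0 < ρ) (h : η ∈ S.stoppedCylinder ρ ξ) :
    S.stoppingTime ρ η = S.stoppingTime ρ ξ := by
  have hle : S.stoppingTime ρ η ≤ S.stoppingTime ρ ξ :=
    S.stoppingTime_le ((S.rate_eq_of_mem_cylinder h).trans_le (S.rate_stoppingTime_le hρ ξ))
  refine hle.antisymm (S.stoppingTime_le ?_)
  rw [← S.rate_eq_of_mem_cylinder (PiNat.cylinder_anti ξ hle h)]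
  exact S.rate_stoppingTime_le hρ η

lemma mem_stoppedCylinder_self (ρ : ℝ) (ξ : ∀ j, ι j) : ξ ∈ S.stoppedCylinder ρ ξ :=
  PiNat.self_mem_cylinder ξ _

lemma stoppedCylinder_eq_of_mem (hρ : 0 < ρ) (h : η ∈ S.stoppedCylinder ρ ξ) :
    S.stoppedCylinder ρ η = S.stoppedCylinder ρ ξ := by
  rw [stoppedCylinder, S.stoppingTime_eq_of_mem hρ h]
  exact PiNat.mem_cylinder_iff_eq.1 h

lemma firstDiff_lt_stoppingTime (h : η ∉ S.stoppedCylinder ρ ξ) :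
    PiNat.firstDiff ξ η < S.stoppingTime ρ ξ := by
  have hne : η ≠ ξ := by
    rintro rfl
    exact h (S.mem_stoppedCylinder_self ρ η)
  rwa [stoppedCylinder, PiNat.mem_cylinder_iff_le_firstDiff hne, not_le,
    PiNat.firstDiff_comm] at h

lemma exists_subset_pairwise_notMem_stoppedCylinder (hρ : 0 < ρ) (V : Set (∀ j, ι j)) :
    ∃ W ⊆ V, (W.Pairwise fun ξ η => η ∉ S.stoppedCylinder ρ ξ) ∧
      V ⊆ ⋃ ξ ∈ W, S.stoppedCylinder ρ ξ := by
  obtain ⟨W, hWV, hW⟩ := (surjOn_image (S.stoppedCylinder ρ) V).exists_bijOn_subset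
  refine ⟨W, hWV, fun ξ hξ η hη hne hmem => ?_, fun ζ hζ => ?_⟩
  · exact hne (hW.injOn hξ hη (S.stoppedCylinder_eq_of_mem hρ hmem).symm)
  · obtain ⟨ξ, hξ, hζξ⟩ := hW.surjOn (mem_image_of_mem _ hζ)
    exact mem_iUnion₂.2 ⟨ξ, hξ, hζξ ▸ S.mem_stoppedCylinder_self ρ ζ⟩

lemma stoppedCylinder_subset_preimage_ball {Δ : Set E} (hΔ : Bornology.IsBounded Δ)
    {π : (∀ j, ι j) → E} (hπ : ∀ ξ m, π ξ ∈ S.comp ξ m '' Δ) (hρ : 0 < ρ) {r : ℝ}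
    (hr : ρ * Metric.diam Δ < r) {x : E} (hx : x ∈ S.stoppedComp ρ ξ '' Δ) :
    S.stoppedCylinder ρ ξ ⊆ π ⁻¹' Metric.ball x r := by
  intro η hη
  obtain ⟨y, hy, rfl⟩ := hx
  obtain ⟨z, hz, hzη⟩ := hπ η (S.stoppingTime ρ ξ)
  rw [mem_preimage, ← hzη, S.comp_eq_of_mem_cylinder hη, Metric.mem_ball, stoppedComp,
    S.dist_comp]
  exact (mul_le_mul (S.rate_stoppingTime_le hρ ξ) (Metric.dist_le_diam_of_mem hΔ hz hy)
    dist_nonneg hρ.le).trans_lt hr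

end Basic

section CodingMap

variable {E : Type*} [MetricSpace E] {ι : ℕ → Type*} (S : SimilaritySystem E ι)

lemma comp_injective (ξ : ∀ j, ι j) (m : ℕ) : Function.Injective (S.comp ξ m) := fun x y hxy => by
  have h := S.dist_comp ξ m x y
  rw [hxy, dist_self, zero_eq_mul, or_iff_right (S.rate_pos ξ m).ne'] at h
  exact dist_eq_zero.1 h

lemma disjoint_image_comp {O : Set E} (hO : S.IsFeasible O) {ξ η : ∀ j, ι j} (hne : ξ ≠ η)
    {m n : ℕ} (hm : PiNat.firstDiff ξ η < m) (hn : PiNat.firstDiff ξ η < n) :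
    Disjoint (S.comp ξ m '' O) (S.comp η n '' O) := by
  refine Disjoint.mono (S.image_comp_subset_of_le hO.mapsTo ξ (Nat.succ_le_of_lt hm))
    (S.image_comp_subset_of_le hO.mapsTo η (Nat.succ_le_of_lt hn)) ?_
  have hmem : η ∈ PiNat.cylinder ξ (PiNat.firstDiff ξ η) := fun j hj =>
    (PiNat.apply_eq_of_lt_firstDiff hj).symm
  rw [comp, comp, image_comp, image_comp, S.comp_eq_of_mem_cylinder hmem,
    disjoint_image_iff (S.comp_injective _ _)]
  exact hO.pairwise_disjoint _ (PiNat.apply_firstDiff_ne hne)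

lemma continuous_map (j : ℕ) (i : ι j) : Continuous (S.map j i) :=
  (LipschitzWith.of_dist_le' fun x y => (S.dist_map j i x y).le).continuous

lemma continuous_comp (ξ : ∀ j, ι j) (m : ℕ) : Continuous (S.comp ξ m) :=
  (LipschitzWith.of_dist_le' fun x y => (S.dist_comp ξ m x y).le).continuous

variable [∀ j, Countable (ι j)] [∀ j, MeasurableSpace (ι j)]
  [∀ j, MeasurableSingletonClass (ι j)] [MeasurableSpace E] [BorelSpace E]

lemma measurable_comp (m : ℕ) {Y : (∀ j, ι j) → E} (hY : Measurable Y) :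
    Measurable fun ξ => S.comp ξ m (Y ξ) := by
  induction m generalizing Y with
  | zero => exact hY
  | succ m ih =>
    have hmap : Measurable fun p : ι m × E => S.map m p.1 p.2 :=
      measurable_from_prod_countable_right fun i => (S.continuous_map m i).measurable
    exact ih (hmap.comp ((measurable_pi_apply m).prodMk hY))

lemma exists_measurable_codingMap [CompleteSpace E] {Δ : Set E} (hc : IsCompact Δ)
    (hne : Δ.Nonempty) (hΔ : ∀ j i, MapsTo (S.map j i) Δ Δ) :
    ∃ π : (∀ j, ι j) → E, Measurable π ∧ ∀ ξ m, π ξ ∈ S.comp ξ m '' Δ := by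
  obtain ⟨x₀, hx₀⟩ := hne
  have hcauchy (ξ : ∀ j, ι j) : CauchySeq fun m => S.comp ξ m x₀ := by
    refine cauchySeq_of_le_geometric S.cmax (Metric.diam Δ) S.cmax_lt_one fun m => ?_
    rw [comp, Function.comp_apply, S.dist_comp, mul_comm]
    exact mul_le_mul (Metric.dist_le_diam_of_mem hc.isBounded hx₀ (hΔ _ _ hx₀))
      (S.rate_le_pow ξ m) (S.rate_pos ξ m).le Metric.diam_nonneg
  choose π hπ using fun ξ => cauchySeq_tendsto_of_complete (hcauchy ξ)
  refine ⟨π, measurable_of_tendsto_metrizable (fun m => S.measurable_comp m measurable_const)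
    (tendsto_pi_nhds.2 hπ), fun ξ m => ?_⟩
  refine (hc.image (S.continuous_comp ξ m)).isClosed.mem_of_tendsto (hπ ξ) ?_
  filter_upwards [eventually_ge_atTop m] with n hmn
  exact S.image_comp_subset_of_le hΔ ξ hmn (mem_image_of_mem _ hx₀)

end CodingMap

section BranchMeasure

variable {E : Type*} [PseudoMetricSpace E] {ι : ℕ → Type*} (S : SimilaritySystem E ι)
  [∀ j, Fintype (ι j)]

/-- The sum of the `s`-th powers of the contraction ratios at level `j`. -/
noncomputable def total (s : ℝ) (j : ℕ) : ℝ := ∑ i, S.ratio j i ^ s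

/-- The pressure of the system at the exponent `s` exists and vanishes; this is the
non-autonomous form of Moran's equation `∑ i, ratio i ^ s = 1`. -/
def HasZeroPressure (s : ℝ) : Prop :=
  Tendsto (fun n : ℕ => (∑ j ∈ Finset.range n, Real.log (S.total s j)) / n) atTop (𝓝 0)

/-- The probability measure on `ι j` with weights proportional to `ratio j i ^ s`. -/
noncomputable def levelMeasure [∀ j, MeasurableSpace (ι j)] (s : ℝ) (j : ℕ) : Measure (ι j) :=
  ∑ i, ENNReal.ofReal (S.ratio j i ^ s / S.total s j) • Measure.dirac i

lemma levelMeasure_singleton [∀ j, MeasurableSpace (ι j)]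
    [∀ j, MeasurableSingletonClass (ι j)] (s : ℝ) (j : ℕ) (i : ι j) :
    S.levelMeasure s j {i} = ENNReal.ofReal (S.ratio j i ^ s / S.total s j) := by
  classical
  simp [levelMeasure, Measure.coe_finsetSum, Finset.sum_apply, Set.indicator_apply]

variable [∀ j, Nonempty (ι j)]

lemma total_pos (s : ℝ) (j : ℕ) : 0 < S.total s j :=
  Finset.sum_pos (fun i _ => Real.rpow_pos_of_pos (S.ratio_pos j i) s) Finset.univ_nonempty

lemma exists_exp_abs_sum_log_total_le {s : ℝ} (hs : S.HasZeroPressure s) {ε : ℝ} (hε : 0 < ε) :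
    ∃ A : ℝ, 0 < A ∧ ∀ ξ m,
      Real.exp |∑ j ∈ Finset.range m, Real.log (S.total s j)| ≤ A * S.rate ξ m ^ (-ε) := by
  have hcmax : 0 < S.cmax := (S.ratio_pos 0 (Classical.arbitrary _)).trans_le (S.le_cmax 0 _)
  obtain ⟨C, hC⟩ := exists_abs_le_mul_add_of_tendsto hs
    (mul_pos hε (neg_pos.2 (Real.log_neg hcmax S.cmax_lt_one)))
  refine ⟨Real.exp C, Real.exp_pos C, fun ξ m => ?_⟩
  have hrate : Real.log (S.rate ξ m) ≤ m * Real.log S.cmax := by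
    rw [← Real.log_pow]
    exact Real.log_le_log (S.rate_pos ξ m) (S.rate_le_pow ξ m)
  rw [Real.rpow_def_of_pos (S.rate_pos ξ m), ← Real.exp_add, Real.exp_le_exp]
  linarith [hC m, mul_le_mul_of_nonneg_left hrate hε.le]

lemma ratio_rpow_div_total_nonneg (s : ℝ) (j : ℕ) (i : ι j) :
    0 ≤ S.ratio j i ^ s / S.total s j :=
  div_nonneg (Real.rpow_nonneg (S.ratio_pos j i).le s) (S.total_pos s j).le

variable [∀ j, MeasurableSpace (ι j)]

instance (s : ℝ) (j : ℕ) : IsProbabilityMeasure (S.levelMeasure s j) := by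
  constructor
  simp only [levelMeasure, Measure.coe_finsetSum, Finset.sum_apply, Measure.smul_apply,
    measure_univ, smul_eq_mul, mul_one]
  rw [← ENNReal.ofReal_sum_of_nonneg fun i _ => S.ratio_rpow_div_total_nonneg s j i,
    ← Finset.sum_div, ← total, div_self (S.total_pos s j).ne', ENNReal.ofReal_one]

/-- The law of a random branch whose steps are independent with laws `S.levelMeasure s j`. -/
noncomputable def branchMeasure (s : ℝ) : Measure (∀ j, ι j) :=
  Measure.infinitePi (S.levelMeasure s)

instance (s : ℝ) : IsProbabilityMeasure (S.branchMeasure s) := by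
  unfold branchMeasure
  infer_instance

variable [∀ j, MeasurableSingletonClass (ι j)]

lemma branchMeasure_cylinder (s : ℝ) (ξ : ∀ j, ι j) (m : ℕ) :
    S.branchMeasure s (PiNat.cylinder ξ m) = ENNReal.ofReal
      (S.rate ξ m ^ s * Real.exp (-∑ j ∈ Finset.range m, Real.log (S.total s j))) := by
  rw [PiNat.cylinder_eq_pi, branchMeasure,
    Measure.infinitePi_pi _ fun j _ => measurableSet_singleton _]
  simp_rw [levelMeasure_singleton]
  rw [← ENNReal.ofReal_prod_of_nonneg fun j _ => S.ratio_rpow_div_total_nonneg s j _,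
    Finset.prod_div_distrib, Real.finsetProd_rpow _ _ fun j _ => (S.ratio_pos j _).le,
    Real.exp_neg, Real.exp_sum, Finset.prod_congr rfl fun j _ => Real.exp_log (S.total_pos s j),
    rate, div_eq_mul_inv]

lemma exists_le_branchMeasure_cylinder {s t : ℝ} (hs : S.HasZeroPressure s) (hst : s < t) :
    ∃ c : ℝ, 0 < c ∧ ∀ ξ m,
      ENNReal.ofReal (c * S.rate ξ m ^ t) ≤ S.branchMeasure s (PiNat.cylinder ξ m) := by
  obtain ⟨A, hA, hexp⟩ := S.exists_exp_abs_sum_log_total_le hs (sub_pos.2 hst)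
  refine ⟨A⁻¹, inv_pos.2 hA, fun ξ m => ?_⟩
  have hrate := S.rate_pos ξ m
  rw [S.branchMeasure_cylinder]
  refine ENNReal.ofReal_le_ofReal ?_
  calc A⁻¹ * S.rate ξ m ^ t
      = S.rate ξ m ^ s * (A * S.rate ξ m ^ (-(t - s)))⁻¹ := by
        rw [mul_inv, ← Real.rpow_neg hrate.le, neg_neg, mul_left_comm, ← Real.rpow_add hrate,
          add_sub_cancel]
    _ ≤ S.rate ξ m ^ s *
          (Real.exp |∑ j ∈ Finset.range m, Real.log (S.total s j)|)⁻¹ := by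
        gcongr
        exact hexp ξ m
    _ ≤ S.rate ξ m ^ s * Real.exp (-∑ j ∈ Finset.range m, Real.log (S.total s j)) := by
        rw [← Real.exp_neg]
        gcongr
        exact le_abs_self _

lemma exists_branchMeasure_cylinder_le {s t : ℝ} (hs : S.HasZeroPressure s) (hts : t < s) :
    ∃ C : ℝ, 0 < C ∧ ∀ ξ m,
      S.branchMeasure s (PiNat.cylinder ξ m) ≤ ENNReal.ofReal (C * S.rate ξ m ^ t) := by
  obtain ⟨A, hA, hexp⟩ := S.exists_exp_abs_sum_log_total_le hs (sub_pos.2 hts)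
  refine ⟨A, hA, fun ξ m => ?_⟩
  have hrate := S.rate_pos ξ m
  rw [S.branchMeasure_cylinder]
  refine ENNReal.ofReal_le_ofReal ?_
  calc S.rate ξ m ^ s * Real.exp (-∑ j ∈ Finset.range m, Real.log (S.total s j))
      ≤ S.rate ξ m ^ s * (A * S.rate ξ m ^ (-(s - t))) := by
        gcongr
        exact (Real.exp_le_exp.2 (neg_le_abs _)).trans (hexp ξ m)
    _ = A * S.rate ξ m ^ t := by
        rw [mul_left_comm, ← Real.rpow_add hrate, neg_sub, add_sub_cancel]

lemma exists_le_map_branchMeasure_ball [MeasurableSpace E] [OpensMeasurableSpace E]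
    {Δ : Set E} {π : (∀ j, ι j) → E} {s t : ℝ} (hΔ : Bornology.IsBounded Δ)
    (hΔS : ∀ j i, MapsTo (S.map j i) Δ Δ) (hs₀ : 0 < s) (hs : S.HasZeroPressure s)
    (hπm : Measurable π) (hπ : ∀ ξ m, π ξ ∈ S.comp ξ m '' Δ) (hst : s < t) :
    ∃ c : ℝ, 0 < c ∧ ∀ x ∈ S.limitSet Δ, ∀ r, 0 < r → r ≤ 1 →
      ENNReal.ofReal (c * r ^ t) ≤ (S.branchMeasure s).map π (Metric.ball x r) := by
  obtain ⟨c, hc, hcyl⟩ := S.exists_le_branchMeasure_cylinder hs hst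
  have hcmin := S.cmin_pos
  set D := Metric.diam Δ + 1
  have hD₁ : 1 ≤ D := le_add_of_nonneg_left Metric.diam_nonneg
  refine ⟨c * (S.cmin / D) ^ t, by positivity, fun x hx r hr₀ hr₁ => ?_⟩
  have hρ : 0 < r / D := by positivity
  have hρr : r / D * Metric.diam Δ < r := by
    rw [div_mul_comm, mul_lt_iff_lt_one_left hr₀, div_lt_one (by positivity)]
    exact lt_add_one _
  obtain ⟨ξ, hξ⟩ := S.exists_mem_image_stoppedComp hΔS hρ hx
  rw [Measure.map_apply hπm Metric.isOpen_ball.measurableSet]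
  calc ENNReal.ofReal (c * (S.cmin / D) ^ t * r ^ t)
      = ENNReal.ofReal (c * (S.cmin * (r / D)) ^ t) := by
        rw [mul_assoc, ← Real.mul_rpow (by positivity) hr₀.le, div_mul_eq_mul_div, mul_div_assoc]
    _ ≤ ENNReal.ofReal (c * S.rate ξ (S.stoppingTime (r / D) ξ) ^ t) := by
        gcongr
        · exact (hs₀.trans hst).le
        · exact S.le_rate_stoppingTime hρ.le (div_le_one_of_le₀ (hr₁.trans hD₁) (by positivity)) ξ
    _ ≤ S.branchMeasure s (S.stoppedCylinder (r / D) ξ) := hcyl ξ _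
    _ ≤ S.branchMeasure s (π ⁻¹' Metric.ball x r) :=
        measure_mono (S.stoppedCylinder_subset_preimage_ball hΔ hπ hρ hρr hξ)

end BranchMeasure

section Regularity

variable {E : Type*} [NormedAddCommGroup E] [NormedSpace ℝ E] [StrictConvexSpace ℝ E]
  [FiniteDimensional ℝ E] {ι : ℕ → Type*} (S : SimilaritySystem E ι) {Δ O : Set E}

lemma mul_le_dist_stoppedComp (hO : S.IsFeasible O) {a : E} {δ : ℝ} (hδ : 0 < δ)
    (haO : Metric.ball a δ ⊆ O) {ρ : ℝ} (hρ₀ : 0 < ρ) (hρ₁ : ρ ≤ 1) {ξ η : ∀ j, ι j}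
    (h : η ∉ S.stoppedCylinder ρ ξ) :
    S.cmin * δ * ρ ≤ dist (S.stoppedComp ρ ξ a) (S.stoppedComp ρ η a) := by
  have hne : ξ ≠ η := fun heq => h (heq ▸ S.mem_stoppedCylinder_self ρ ξ)
  have h' : ξ ∉ S.stoppedCylinder ρ η := fun hξ =>
    h (S.stoppedCylinder_eq_of_mem hρ₀ hξ ▸ S.mem_stoppedCylinder_self ρ η)
  have hdisj := S.disjoint_image_comp hO hne (S.firstDiff_lt_stoppingTime h)
    (PiNat.firstDiff_comm ξ η ▸ S.firstDiff_lt_stoppingTime h')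
  by_contra! hlt
  have hmem : S.stoppedComp ρ η a ∈ S.stoppedComp ρ ξ '' Metric.ball a δ := by
    rw [stoppedComp, image_ball_of_dist_eq_mul (S.rate_pos ξ _) (S.dist_comp ξ _),
      Metric.mem_ball']
    calc dist (S.stoppedComp ρ ξ a) (S.stoppedComp ρ η a) < S.cmin * ρ * δ := by
          rwa [mul_right_comm]
      _ ≤ S.rate ξ (S.stoppingTime ρ ξ) * δ := by
          gcongr
          exact S.le_rate_stoppingTime hρ₀.le hρ₁ ξ
  exact disjoint_left.1 hdisj (image_mono haO hmem)
    (mem_image_of_mem _ (haO (Metric.mem_ball_self hδ)))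

lemma exists_encard_le_of_pairwise_notMem_stoppedCylinder (hO : S.IsFeasible O)
    (hΔ : Bornology.IsBounded Δ) :
    ∃ M : ℕ, ∀ (ρ : ℝ) (U : Set E) (W : Set (∀ j, ι j)), 0 < ρ → ρ ≤ 1 →
      Metric.ediam U ≤ ENNReal.ofReal ρ → (∀ ξ ∈ W, (S.stoppedComp ρ ξ '' Δ ∩ U).Nonempty) →
      (W.Pairwise fun ξ η => η ∉ S.stoppedCylinder ρ ξ) → W.encard ≤ M := by
  have := FiniteDimensional.proper ℝ E
  obtain ⟨a, ha⟩ := hO.nonempty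
  obtain ⟨δ, hδ, haO⟩ := Metric.isOpen_iff.1 hO.isOpen a ha
  obtain ⟨K, hΔK⟩ := hΔ.subset_closedBall a
  obtain ⟨M, hM⟩ := exists_encard_le_of_pairwise_le_dist E (∀ j, ι j) (K + 1)
    (mul_pos S.cmin_pos hδ)
  refine ⟨M, fun ρ U W hρ₀ hρ₁ hU hWU hW => ?_⟩
  rcases W.eq_empty_or_nonempty with rfl | ⟨ξ₀, hξ₀⟩
  · simp
  obtain ⟨x, -, hxU⟩ := hWU ξ₀ hξ₀
  refine hM ρ x W (fun ξ => S.stoppedComp ρ ξ a) hρ₀ (fun ξ hξ => ?_) fun ξ hξ η hη hne =>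
    S.mul_le_dist_stoppedComp hO hδ haO hρ₀ hρ₁ (hW hξ hη hne)
  obtain ⟨_, ⟨y, hy, rfl⟩, hyU⟩ := hWU ξ hξ
  have hay : dist (S.stoppedComp ρ ξ a) (S.stoppedComp ρ ξ y) ≤ ρ * K := by
    rw [stoppedComp, S.dist_comp]
    exact mul_le_mul (S.rate_stoppingTime_le hρ₀ ξ) (Metric.mem_closedBall'.1 (hΔK hy))
      dist_nonneg hρ₀.le
  have hyx : dist (S.stoppedComp ρ ξ y) x ≤ ρ := by
    have h := (Metric.edist_le_ediam_of_mem hyU hxU).trans hU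
    rwa [edist_dist, ENNReal.ofReal_le_ofReal_iff hρ₀.le] at h
  rw [Metric.mem_closedBall]
  linarith [dist_triangle (S.stoppedComp ρ ξ a) (S.stoppedComp ρ ξ y) x]

variable [∀ j, Fintype (ι j)] [∀ j, MeasurableSpace (ι j)] [∀ j, MeasurableSingletonClass (ι j)]
  [∀ j, Nonempty (ι j)] [MeasurableSpace E] [BorelSpace E] {s t : ℝ} {π : (∀ j, ι j) → E}

lemma exists_map_branchMeasure_le (hO : S.IsFeasible O) (hΔ : Bornology.IsBounded Δ)
    (hs : S.HasZeroPressure s) (hπm : Measurable π) (hπ : ∀ ξ m, π ξ ∈ S.comp ξ m '' Δ)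
    (ht : 0 < t) (hts : t < s) :
    ∃ C : ℝ, 0 < C ∧ ∀ U ρ, 0 < ρ → Metric.ediam U ≤ ENNReal.ofReal ρ →
      (S.branchMeasure s).map π U ≤ ENNReal.ofReal (C * ρ ^ t) := by
  obtain ⟨C, hC, hcyl⟩ := S.exists_branchMeasure_cylinder_le hs hts
  obtain ⟨M, hM⟩ := S.exists_encard_le_of_pairwise_notMem_stoppedCylinder hO hΔ
  refine ⟨max (M * C) 1, by positivity, fun U ρ hρ₀ hU => ?_⟩
  rcases lt_or_ge 1 ρ with hρ₁ | hρ₁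
  · have := Measure.isProbabilityMeasure_map (μ := S.branchMeasure s) hπm.aemeasurable
    refine prob_le_one.trans (ENNReal.one_le_ofReal.2 ?_)
    exact one_le_mul_of_one_le_of_one_le (le_max_right _ _) (Real.one_le_rpow hρ₁.le ht.le)
  obtain ⟨W, hWV, hW, hVW⟩ :=
    S.exists_subset_pairwise_notMem_stoppedCylinder hρ₀ (π ⁻¹' closure U)
  have hcard : W.encard ≤ M := hM ρ (closure U) W hρ₀ hρ₁ (by rwa [Metric.ediam_closure])
    (fun ξ hξ => ⟨π ξ, hπ ξ _, hWV hξ⟩) hW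
  have hstopped (ξ : ∀ j, ι j) :
      S.branchMeasure s (S.stoppedCylinder ρ ξ) ≤ ENNReal.ofReal (C * ρ ^ t) := by
    refine (hcyl ξ _).trans (ENNReal.ofReal_le_ofReal ?_)
    gcongr
    · exact (S.rate_pos ξ _).le
    · exact S.rate_stoppingTime_le hρ₀ ξ
  calc (S.branchMeasure s).map π U ≤ (S.branchMeasure s).map π (closure U) :=
        measure_mono subset_closure
    _ = S.branchMeasure s (π ⁻¹' closure U) :=
        Measure.map_apply hπm isClosed_closure.measurableSet
    _ ≤ W.encard * ENNReal.ofReal (C * ρ ^ t) :=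
        measure_le_encard_mul _ (finite_of_encard_le_coe hcard).countable
          (fun ξ _ => hstopped ξ) hVW
    _ ≤ (M : ℝ≥0∞) * ENNReal.ofReal (C * ρ ^ t) := by
        gcongr
        exact_mod_cast ENat.toENNReal_le.2 hcard
    _ = ENNReal.ofReal (M * C * ρ ^ t) := by
        rw [mul_assoc, ENNReal.ofReal_mul M.cast_nonneg, ENNReal.ofReal_natCast]
    _ ≤ ENNReal.ofReal (max (M * C) 1 * ρ ^ t) := by
        gcongr
        exact le_max_left _ _

theorem isQuasiAssouadDim_limitSet (hO : S.IsFeasible O) (hΔ : IsCompact Δ) (hne : Δ.Nonempty)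
    (hΔS : ∀ j i, MapsTo (S.map j i) Δ Δ) (hs₀ : 0 < s) (hs : S.HasZeroPressure s) :
    IsQuasiAssouadDim (S.limitSet Δ) (dimH (S.limitSet Δ)) := by
  have := FiniteDimensional.complete ℝ E
  obtain ⟨π, hπm, hπ⟩ := S.exists_measurable_codingMap hΔ hne hΔS
  have hregular : IsAlmostRegular ((S.branchMeasure s).map π) (S.limitSet Δ) s :=
    ⟨fun _ => S.exists_le_map_branchMeasure_ball hΔ.isBounded hΔS hs₀ hs hπm hπ,
      fun _ => S.exists_map_branchMeasure_le hO hΔ.isBounded hs hπm hπ⟩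
  refine hregular.isQuasiAssouadDim hs₀ ?_ (hΔ.isBounded.subset (S.limitSet_subset hΔS))
  have hpre : π ⁻¹' S.limitSet Δ = univ := eq_univ_of_forall fun ξ =>
    mem_iInter₂.2 fun n _ => mem_iUnion.2 ⟨ξ, hπ ξ n⟩
  have hle := Measure.le_map_apply (μ := S.branchMeasure s) hπm.aemeasurable (S.limitSet Δ)
  rw [hpre, measure_univ] at hle
  exact (one_pos.trans_le hle).ne'

end Regularity

end SimilaritySystem

lemma ae_tendsto_sum_div_infinitePi {Ω : Type*} [MeasurableSpace Ω] {μ : Measure Ω}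
    [IsProbabilityMeasure μ] {f : Ω → ℝ} (hf : Measurable f) (hint : Integrable f μ) :
    ∀ᵐ ω ∂Measure.infinitePi fun _ : ℕ => μ,
      Tendsto (fun n : ℕ => (∑ j ∈ Finset.range n, f (ω j)) / n) atTop (𝓝 (∫ x, f x ∂μ)) := by
  have heval (j : ℕ) : MeasurePreserving (Function.eval j) (Measure.infinitePi fun _ => μ) μ :=
    measurePreserving_eval_infinitePi (fun _ => μ) j
  have hident (j : ℕ) : ProbabilityTheory.IdentDistrib (fun ω : ℕ → Ω => f (ω j))
      (fun ω => f (ω 0)) (Measure.infinitePi fun _ => μ) (Measure.infinitePi fun _ => μ) :=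
    ((heval j).hasLaw.identDistrib (heval 0).hasLaw).comp hf
  have hindep : ProbabilityTheory.iIndepFun (fun (j : ℕ) (ω : ℕ → Ω) => f (ω j))
      (Measure.infinitePi fun _ => μ) :=
    ProbabilityTheory.iIndepFun_infinitePi fun _ => hf
  have hmean : ∫ ω, f (ω 0) ∂Measure.infinitePi (fun _ : ℕ => μ) = ∫ x, f x ∂μ :=
    (heval 0).hasLaw.integral_comp hf.aestronglyMeasurable
  have hslln := ProbabilityTheory.strong_law_ae_real (μ := Measure.infinitePi fun _ : ℕ => μ)
    (fun j ω => f (ω j)) ((heval 0).integrable_comp_of_integrable hint)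
    (fun _ _ hij => hindep.indepFun hij) hident
  rwa [hmean] at hslln

namespace RIFS

variable {k d : ℕ} {L : RIFS k d}

instance : IsProbabilityMeasure L.μ := L.isProbabilityMeasure_μ

/-- The indices of the maps of the iterated function system `l`. -/
abbrev Branch (l : L.Λ) : Type := {i : Fin L.maxMaps // (i : ℕ) < L.numMaps l}

lemma card_branch (l : L.Λ) : Fintype.card (Branch l) = L.numMaps l := by
  rw [Fintype.card_subtype, Fin.card_filter_val_lt, min_eq_right (L.numMaps_le l)]

lemma nonempty_branch_iff {l : L.Λ} :
    Nonempty (Branch l) ↔ (l : EuclideanSpace ℝ (Fin k)) ≠ 0 := by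
  rw [← Fintype.card_pos_iff, card_branch, Nat.pos_iff_ne_zero, Ne, L.numMaps_eq_zero_iff]

lemma ae_nonempty_branch (hzero : L.μ {l | (l : EuclideanSpace ℝ (Fin k)) = 0} = 0) :
    ∀ᵐ l ∂L.μ, Nonempty (Branch l) := by
  simp_rw [nonempty_branch_iff]
  exact measure_eq_zero_iff_ae_notMem.1 hzero

variable (L) in
/-- The contraction condition with the explicit bounds `cmin` and `cmax`. -/
structure HasRatioBounds (cmin cmax : ℝ) : Prop where
  cmin_pos : 0 < cmin
  cmin_le_cmax : cmin ≤ cmax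
  cmax_lt_one : cmax < 1
  cmin_le : ∀ (l : L.Λ) (i : Branch l), cmin ≤ L.ratio l i
  le_cmax : ∀ (l : L.Λ) (i : Branch l), L.ratio l i ≤ cmax

lemma ContractionCondition.exists_hasRatioBounds (h : L.ContractionCondition) :
    ∃ cmin cmax, L.HasRatioBounds cmin cmax :=
  let ⟨cmin, cmax, hpos, hle, hlt, hratio⟩ := h
  ⟨cmin, cmax, hpos, hle, hlt, fun l i => (hratio l i i.2).1, fun l i => (hratio l i i.2).2⟩

variable {cmin cmax : ℝ}

section Attractor

/-- The non-autonomous iterated function system that uses the system `ω j` at level `j`. -/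
def HasRatioBounds.system (h : L.HasRatioBounds cmin cmax) (ω : ℕ → L.Λ) :
    SimilaritySystem (EuclideanSpace ℝ (Fin d)) fun j => Branch (ω j) where
  map j i := L.map (ω j) i
  ratio j i := L.ratio (ω j) i
  cmin := cmin
  cmax := cmax
  cmin_pos := h.cmin_pos
  cmax_lt_one := h.cmax_lt_one
  cmin_le _ := h.cmin_le _
  le_cmax _ := h.le_cmax _
  dist_map _ i := L.dist_map _ _ i.2

lemma UOSC.exists_isFeasible (hosc : L.UOSC) (h : L.HasRatioBounds cmin cmax) :
    ∃ O, ∀ ω, (h.system ω).IsFeasible O := by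
  obtain ⟨O, hO, hne, hsub, hdisj⟩ := hosc
  refine ⟨O, fun ω => ⟨hO, hne, fun j i => mapsTo_iff_image_subset.2 (hsub _ _ i.2),
    fun j i i' hii' => ?_⟩⟩
  by_contra hmeet
  exact hii' (Subtype.ext (hdisj _ _ _ i.2 i'.2 (not_disjoint_iff_nonempty_inter.1 hmeet)))

lemma IsAdmissible.mapsTo {Δ : Set (EuclideanSpace ℝ (Fin d))} (hΔ : L.IsAdmissible Δ)
    (h : L.HasRatioBounds cmin cmax) (ω : ℕ → L.Λ) (j : ℕ) (i : Branch (ω j)) :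
    MapsTo ((h.system ω).map j i) Δ Δ :=
  mapsTo_iff_image_subset.2 (hΔ.2.2 _ _ i.2)

lemma HasRatioBounds.system_comp_succ (h : L.HasRatioBounds cmin cmax) (ω : ℕ → L.Λ)
    (ξ : ∀ j, Branch (ω j)) (n : ℕ) :
    (h.system ω).comp ξ (n + 1) =
      L.map (ω 0) (ξ 0) ∘ (h.system fun j => ω (j + 1)).comp (fun j => ξ (j + 1)) n := by
  induction n with
  | zero => rfl
  | succ n ih => rw [SimilaritySystem.comp, ih]; rfl

variable (L) in
/-- The labelling that gives each node the label `ω n` of its level `n`. -/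
def homogeneousLabelling (ω : ℕ → L.Λ) : L.Labelling := fun v => ω v.length

lemma codingsAt_zero (τ : L.Labelling) : codingsAt τ 0 = {[]} := by
  ext e
  simp [codingsAt, coding, eq_comm]

lemma mem_codingsAt_succ {τ : L.Labelling} {n : ℕ} {e : List L.Letter} :
    e ∈ codingsAt τ (n + 1) ↔
      ∃ i : Branch (τ []), ∃ e' ∈ codingsAt (fun w => τ (i :: w)) n, e = (τ [], ↑i) :: e' := by
  constructor
  · rintro ⟨_ | ⟨i, v⟩, hv, he⟩
    · cases hv
    · obtain ⟨a, e', ha, he', rfl⟩ := Option.map₂_eq_some_iff.1 he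
      obtain ⟨hi, ⟨⟩⟩ := Option.ite_none_right_eq_some.1 ha
      exact ⟨⟨i, hi⟩, e', ⟨v, Nat.succ.inj hv, he'⟩, rfl⟩
  · rintro ⟨⟨i, hi⟩, e', ⟨v, rfl, he'⟩, rfl⟩
    exact ⟨i :: v, rfl, Option.map₂_eq_some_iff.2 ⟨_, e', if_pos hi, he', rfl⟩⟩

lemma image_codingMap_codingsAt (h : L.HasRatioBounds cmin cmax) (ω : ℕ → L.Λ)
    [∀ j, Nonempty (Branch (ω j))] (n : ℕ) :
    codingMap '' codingsAt (L.homogeneousLabelling ω) n =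
      range fun ξ => (h.system ω).comp ξ n := by
  induction n generalizing ω with
  | zero => simp [codingsAt_zero, codingMap, SimilaritySystem.comp]
  | succ n ih =>
    specialize ih fun j => ω (j + 1)
    ext f
    constructor
    · rintro ⟨e, he, rfl⟩
      obtain ⟨i, e', he', rfl⟩ := mem_codingsAt_succ.1 he
      obtain ⟨ξ, hξ⟩ := ih.subset (mem_image_of_mem codingMap he')
      refine ⟨fun | 0 => i | j + 1 => ξ j, ?_⟩
      rw [codingMap, ← hξ]
      exact h.system_comp_succ ω _ n
    · rintro ⟨ξ, rfl⟩
      obtain ⟨e', he', hξ⟩ := ih.superset (mem_range_self fun j => ξ (j + 1))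
      refine ⟨(ω 0, ↑(ξ 0)) :: e', mem_codingsAt_succ.2 ⟨ξ 0, e', he', rfl⟩, ?_⟩
      rw [codingMap, hξ]
      exact (h.system_comp_succ ω ξ n).symm

lemma attractor_homogeneousLabelling (h : L.HasRatioBounds cmin cmax) (ω : ℕ → L.Λ)
    [∀ j, Nonempty (Branch (ω j))] (Δ : Set (EuclideanSpace ℝ (Fin d))) :
    attractor Δ (L.homogeneousLabelling ω) = (h.system ω).limitSet Δ := by
  refine iInter₂_congr fun n _ => ?_
  rw [← biUnion_image (f := codingMap) (g := fun f => f '' Δ), image_codingMap_codingsAt h,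
    biUnion_range]

lemma measurableEmbedding_homogeneousLabelling [Nonempty (Fin L.maxMaps)] :
    MeasurableEmbedding L.homogeneousLabelling := by
  let spine (n : ℕ) : L.Node := List.replicate n (Classical.arbitrary _)
  have hlength (n : ℕ) : (spine n).length = n := List.length_replicate
  have hrange : range L.homogeneousLabelling = ⋂ v, {τ | τ v = τ (spine v.length)} := by
    ext τ
    refine ⟨?_, fun hτ => ⟨fun n => τ (spine n), funext fun v => (mem_iInter.1 hτ v).symm⟩⟩
    rintro ⟨ω, rfl⟩
    refine mem_iInter.2 fun v => ?_
    rw [mem_ofPred_eq, homogeneousLabelling, homogeneousLabelling, hlength]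
  refine MeasurableEmbedding.of_measurable_inverse (g := fun τ n => τ (spine n))
    (measurable_pi_lambda _ fun v => measurable_pi_apply v.length) ?_
    (measurable_pi_lambda _ fun n => measurable_pi_apply _)
    fun ω => funext fun n => congrArg ω (hlength n)
  rw [hrange]
  exact MeasurableSet.iInter fun v =>
    measurableSet_eq_fun (measurable_pi_apply _) (measurable_pi_apply _)

end Attractor

section Pressure

variable (L) in
/-- The sum of the `t`-th powers of the contraction rates of the system `l`. -/
noncomputable def total (t : ℝ) (l : L.Λ) : ℝ := ∑ i : Branch l, L.ratio l i ^ t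

lemma total_zero (l : L.Λ) : L.total 0 l = L.numMaps l := by
  simp [total, ← card_branch]

lemma measurable_total (t : ℝ) : Measurable (L.total t) := by
  have hsum : L.total t = fun l => ∑ i : Fin L.maxMaps, if (i : ℕ) < L.numMaps l then
      (if (i : ℕ) < L.numMaps l then L.ratio l i else 0) ^ t else 0 := by
    ext l
    rw [total, ← Finset.sum_filter]
    refine ((Finset.sum_subtype _ (by simp) _).trans (Finset.sum_congr rfl fun i _ => ?_)).symm
    rw [if_pos i.2]
  rw [hsum]
  exact Finset.measurable_fun_sum _ fun i _ => Measurable.ite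
    (measurableSet_lt measurable_const L.measurable_numMaps)
    ((L.measurable_ratio i).pow_const t) measurable_const

variable {t T : ℝ} {l : L.Λ}

lemma rpow_le_total (h : L.HasRatioBounds cmin cmax) (ht : 0 ≤ t) [hl : Nonempty (Branch l)] :
    cmin ^ t ≤ L.total t l := by
  obtain ⟨i⟩ := hl
  have hnonneg (j : Branch l) : 0 ≤ L.ratio l j ^ t :=
    Real.rpow_nonneg (h.cmin_pos.le.trans (h.cmin_le l j)) t
  exact (Real.rpow_le_rpow h.cmin_pos.le (h.cmin_le l i) ht).trans
    (Finset.single_le_sum (f := fun j : Branch l => L.ratio l j ^ t) (fun j _ => hnonneg j)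
      (Finset.mem_univ i))

lemma total_pos (h : L.HasRatioBounds cmin cmax) (ht : 0 ≤ t) [Nonempty (Branch l)] :
    0 < L.total t l :=
  (Real.rpow_pos_of_pos h.cmin_pos t).trans_le (rpow_le_total h ht)

lemma total_le (h : L.HasRatioBounds cmin cmax) (ht : 0 ≤ t) (l : L.Λ) :
    L.total t l ≤ L.maxMaps * cmax ^ t := by
  have hcmax : 0 ≤ cmax := h.cmin_pos.le.trans h.cmin_le_cmax
  calc L.total t l ≤ ∑ _i : Branch l, cmax ^ t := Finset.sum_le_sum fun i _ =>
        Real.rpow_le_rpow (h.cmin_pos.le.trans (h.cmin_le l i)) (h.le_cmax l i) ht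
    _ = L.numMaps l * cmax ^ t := by simp [← card_branch]
    _ ≤ L.maxMaps * cmax ^ t := by
        gcongr
        exact L.numMaps_le l

lemma le_log_total (h : L.HasRatioBounds cmin cmax) (ht : 0 ≤ t) [Nonempty (Branch l)] :
    t * Real.log cmin ≤ Real.log (L.total t l) := by
  rw [← Real.log_rpow h.cmin_pos]
  exact Real.log_le_log (Real.rpow_pos_of_pos h.cmin_pos t) (rpow_le_total h ht)

lemma log_total_le (h : L.HasRatioBounds cmin cmax) (ht : 0 ≤ t) [hl : Nonempty (Branch l)] :
    Real.log (L.total t l) ≤ Real.log L.maxMaps + t * Real.log cmax := by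
  have hcmax : 0 < cmax := h.cmin_pos.trans_le h.cmin_le_cmax
  have hmax : (L.maxMaps : ℝ) ≠ 0 := by
    have := hl.some.1.pos
    positivity
  rw [← Real.log_rpow hcmax, ← Real.log_mul hmax (Real.rpow_pos_of_pos hcmax t).ne']
  exact Real.log_le_log (total_pos h ht) (total_le h ht l)

lemma abs_log_total_le (h : L.HasRatioBounds cmin cmax) (ht : 0 ≤ t) (htT : t ≤ T)
    [Nonempty (Branch l)] :
    |Real.log (L.total t l)| ≤ T * -Real.log cmin + Real.log L.maxMaps := by
  have hcmax : Real.log cmax < 0 :=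
    Real.log_neg (h.cmin_pos.trans_le h.cmin_le_cmax) h.cmax_lt_one
  have hcmin : Real.log cmin < 0 :=
    Real.log_neg h.cmin_pos (h.cmin_le_cmax.trans_lt h.cmax_lt_one)
  have hmax : 0 ≤ Real.log L.maxMaps := Real.log_natCast_nonneg _
  rw [abs_le]
  constructor
  · nlinarith [le_log_total h ht (l := l)]
  · nlinarith [log_total_le h ht (l := l)]

variable (hL : ∀ᵐ l ∂L.μ, Nonempty (Branch l))
include hL

lemma ae_norm_log_total_le (h : L.HasRatioBounds cmin cmax) (ht : 0 ≤ t) (htT : t ≤ T) :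
    ∀ᵐ l ∂L.μ, ‖Real.log (L.total t l)‖ ≤ T * -Real.log cmin + Real.log L.maxMaps := by
  filter_upwards [hL] with l _
  exact abs_log_total_le h ht htT

lemma integrable_log_total (h : L.HasRatioBounds cmin cmax) (ht : 0 ≤ t) :
    Integrable (fun l => Real.log (L.total t l)) L.μ :=
  .of_bound (measurable_total t).log.aestronglyMeasurable _ (ae_norm_log_total_le hL h ht le_rfl)

lemma integral_log_total_zero_pos (h : L.HasRatioBounds cmin cmax) (hne : L.NonExtinguishing) :
    0 < ∫ l, Real.log (L.total 0 l) ∂L.μ := by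
  have hnonneg : 0 ≤ fun l => Real.log (L.total 0 l) := fun l => by
    simpa only [total_zero] using! Real.log_natCast_nonneg _
  refine (integral_nonneg hnonneg).lt_of_ne' fun hzero => ?_
  rw [integral_eq_zero_iff_of_nonneg hnonneg (integrable_log_total hL h le_rfl)] at hzero
  have hone : ∀ᵐ l ∂L.μ, (L.numMaps l : ℝ) = 1 := by
    filter_upwards [hzero, hL] with l hlog hl
    rw [total_zero, Pi.zero_apply] at hlog
    have hpos : 0 < L.numMaps l := card_branch l ▸ Fintype.card_pos
    exact Real.eq_one_of_pos_of_log_eq_zero (Nat.cast_pos.2 hpos) hlog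
  refine hne.ne' ?_
  rw [integral_congr_ae hone, integral_const, probReal_univ, one_smul]

lemma continuousOn_integral_log_total (h : L.HasRatioBounds cmin cmax) (T : ℝ) :
    ContinuousOn (fun t => ∫ l, Real.log (L.total t l) ∂L.μ) (Icc 0 T) := by
  refine continuousOn_of_dominated (fun t _ => (measurable_total t).log.aestronglyMeasurable)
    (fun t ht => ae_norm_log_total_le hL h ht.1 ht.2) (integrable_const _) ?_
  filter_upwards [hL] with l _
  refine ContinuousOn.log (continuous_finsetSum _ fun i _ => ?_).continuousOn fun t ht =>
    (total_pos h ht.1).ne'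
  exact Real.continuous_const_rpow (h.cmin_pos.trans_le (h.cmin_le l i)).ne'

lemma exists_integral_log_total_nonpos (h : L.HasRatioBounds cmin cmax) :
    ∃ T, 0 ≤ T ∧ ∫ l, Real.log (L.total T l) ∂L.μ ≤ 0 := by
  have hcmax : Real.log cmax < 0 :=
    Real.log_neg (h.cmin_pos.trans_le h.cmin_le_cmax) h.cmax_lt_one
  have hT : 0 ≤ Real.log L.maxMaps / -Real.log cmax :=
    div_nonneg (Real.log_natCast_nonneg _) (neg_nonneg.2 hcmax.le)
  refine ⟨_, hT, integral_nonpos_of_ae ?_⟩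
  filter_upwards [hL] with l _
  refine (log_total_le h hT).trans_eq ?_
  rw [div_neg, neg_mul, div_mul_cancel₀ _ hcmax.ne, add_neg_cancel, Pi.zero_apply]

lemma exists_integral_log_total_eq_zero (h : L.HasRatioBounds cmin cmax)
    (hne : L.NonExtinguishing) : ∃ s, 0 < s ∧ ∫ l, Real.log (L.total s l) ∂L.μ = 0 := by
  obtain ⟨T, hT, hnonpos⟩ := exists_integral_log_total_nonpos hL h
  have hpos := integral_log_total_zero_pos hL h hne
  obtain ⟨s, hs, hs₀⟩ := intermediate_value_Icc' hT (continuousOn_integral_log_total hL h T)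
    ⟨hnonpos, hpos.le⟩
  refine ⟨s, hs.1.lt_of_ne' ?_, hs₀⟩
  rintro rfl
  exact hpos.ne' hs₀

lemma ae_hasZeroPressure (h : L.HasRatioBounds cmin cmax) {s : ℝ} (hs : 0 ≤ s)
    (hs₀ : ∫ l, Real.log (L.total s l) ∂L.μ = 0) :
    ∀ᵐ ω ∂Measure.infinitePi fun _ : ℕ => L.μ, (h.system ω).HasZeroPressure s := by
  have hlim := ae_tendsto_sum_div_infinitePi (measurable_total s).log
    (integrable_log_total hL h hs)
  rwa [hs₀] at hlim

lemma ae_forall_nonempty_branch :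
    ∀ᵐ ω ∂Measure.infinitePi fun _ : ℕ => L.μ, ∀ j, Nonempty (Branch (ω j)) :=
  ae_all_iff.2 fun j =>
    (measurePreserving_eval_infinitePi (fun _ => L.μ) j).quasiMeasurePreserving.ae hL

end Pressure

end RIFS

theorem mainTheorem3 {k d : ℕ} (L : RIFS k d)
    (hne : L.NonExtinguishing) (hosc : L.UOSC) (hcon : L.ContractionCondition)
    (hzero : L.μ {l | (l : EuclideanSpace ℝ (Fin k)) = 0} = 0)
    (Δ : Set (EuclideanSpace ℝ (Fin d))) (hΔ : L.IsAdmissible Δ) :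
    ∀ᵐ τ ∂L.homogeneousMeasure,
      IsQuasiAssouadDim (RIFS.attractor Δ τ) (dimH (RIFS.attractor Δ τ)) := by
  obtain ⟨cmin, cmax, h⟩ := hcon.exists_hasRatioBounds
  obtain ⟨O, hO⟩ := hosc.exists_isFeasible h
  have hL := RIFS.ae_nonempty_branch hzero
  obtain ⟨s, hs, hs₀⟩ := RIFS.exists_integral_log_total_eq_zero hL h hne
  have : Nonempty (Fin L.maxMaps) :=
    let ⟨_, ⟨i⟩⟩ := hL.exists
    ⟨i.1⟩
  refine (RIFS.measurableEmbedding_homogeneousLabelling (L := L)).ae_map_iff.2 ?_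
  filter_upwards [RIFS.ae_forall_nonempty_branch hL, RIFS.ae_hasZeroPressure hL h hs.le hs₀]
    with ω _ hω
  rw [RIFS.attractor_homogeneousLabelling h]
  exact (h.system ω).isQuasiAssouadDim_limitSet (hO ω) hΔ.1 hΔ.2.1 (hΔ.mapsTo h ω) hs hω
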